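/- Let $n\ge 2$ and let $\overline{\mathbb R^n}=\mathbb R^n\cup\{\infty\}$ be the one-point compactification of $\mathbb R^n$, with the chordal metric $h(x,y)=\frac{|x-y|}{\sqrt{1+|x|^2}\sqrt{1+|y|^2}}$ for $x,y\ne\infty$, $h(x,\infty)=\frac1{\sqrt{1+|x|^2}}$ for $x\neq\infty$, $h(\infty,\infty)=0$. The modulus of a family $\Gamma$ of paths in $\overline{\mathbb R^n}$ is $M(\Gamma)=\inf\int_{\mathbb R^n}\rho^n\,dm$, where $m$ is Lebesgue measure and the infimum is over all Borel functions $\rho:\mathbb R^n\to[0,\infty]$ with $\int_\gamma\rho\,ds\ge1$ for every locally rectifiable $\gamma\in\Gamma$ (a path through $\infty$ is not locally rectifiable). For sets $E,F,D$, let $\Gamma(E,F,D)$ be the family of all paths $\gamma$ on $[0,1]$ with $\gamma(0)\in E$, $\gamma(1)\in F$ and $\gamma(t)\in D$ for all $t\in(0,1)$. Let $D\subset\mathbb R^n$ be a bounded domain, let $D'\subset\overline{\mathbb R^n}$ be a domain, and let $Q:\mathbb R^n\to[0,\infty]$ be Lebesgue measurable with $Q=0$ outside $D$. A map $f:D\to\overline{\mathbb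 R^n}$ is a ring $Q$-mapping at a point $x_0\in D$ if $$M\bigl(f(\Gamma(S(x_0,r_1),S(x_0,r_2),D))\bigr)\le\int_{A\cap D}Q(x)\,\eta^n(|x-x_0|)\,dm(x),\qquad A=\{x\in\mathbb R^n: r_1<|x-x_0|<r_2\},$$ for all $0<r_1<r_2<\sup_{x\in D}|x-x_0|$ and every measurable $\eta:(r_1,r_2)\to[0,\infty]$ with $\int_{r_1}^{r_2}\eta(r)\,dr\ge1$. Here $S(x_0,r)=\{x\in\mathbb R^n:|x-x_0|=r\}$, and $f(\Gamma)$ is the family of the paths $f\circ\gamma$, $\gamma\in\Gamma$, each restricted to the set of parameters $t\in[0,1]$ with $\gamma(t)\in D$. Let $\mathfrak R_Q(D,D')$ be the family of all homeomorphisms $g$ of $D'$ onto $D$ such that $f=g^{-1}$ is a ring $Q$-mapping at every point of $D$. If $Q\in L^1(D)$, then $\mathfrak R_Q(D,D')$ is equicontinuous in $D'$: for every $y_0\in D'$ and every $\varepsilon>0$ there is $\delta>0$ such that $|g(y)-g(y_0)|<\varepsilon$ for all $g\in\mathfrak R_Q(D,D')$ and all $y\in D'$ with $h(y,y_0)<\delta$.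 -/

import Mathlib

open Set MeasureTheory
open scoped ENNReal OnePoint

noncomputable section

namespace RingHomeo

/-- Euclidean `n`-space; its one-point compactification is `OnePoint (Space n)`. -/
abbrev Space (n : ℕ) : Type := EuclideanSpace ℝ (Fin n)

/-- The chordal (spherical) distance on the extended space. -/
def chordal {n : ℕ} : OnePoint (Space n) → OnePoint (Space n) → ℝ
  | OnePoint.infty, OnePoint.infty => 0
  | OnePoint.infty, OnePoint.some y => 1 / Real.sqrt (1 + ‖y‖ ^ 2)
  | OnePoint.some x, OnePoint.infty => 1 / Real.sqrt (1 + ‖x‖ ^ 2)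
  | OnePoint.some x, OnePoint.some y =>
      ‖x - y‖ / (Real.sqrt (1 + ‖x‖ ^ 2) * Real.sqrt (1 + ‖y‖ ^ 2))

/-- A domain: a nonempty connected open set. -/
def IsDomainSet {X : Type*} [TopologicalSpace X] (D : Set X) : Prop :=
  IsOpen D ∧ IsConnected D

/-- A path given by its parameter interval `dom` (open, closed or half-open) and a function, of
which only the restriction to `dom` matters. -/
structure PPath (X : Type*) where
  /-- The parameter interval. -/
  dom : Set ℝ
  /-- The function; its values outside `dom` are irrelevant. -/
  map : ℝ → X

/-- The integral of `ρ` with respect to arc length over the restriction of `γ` to the compact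
interval `[a, b]`, computed through the arc length parametrization. -/
def arcIntegralOn {n : ℕ} (ρ : Space n → ℝ≥0∞) (γ : ℝ → Space n) (a b : ℝ) : ℝ≥0∞ :=
  ∫⁻ s in Icc (0 : ℝ) (eVariationOn γ (Icc a b)).toReal,
    ρ (naturalParameterization γ (Icc a b) a s)

/-- The integral of `ρ` with respect to arc length over a locally rectifiable path
`γ` on an interval `I`: the supremum of the integrals over the compact subpaths. -/
def arcIntegral {n : ℕ} (ρ : Space n → ℝ≥0∞) (γ : ℝ → Space n) (I : Set ℝ) : ℝ≥0∞ :=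
  ⨆ (a : ℝ) (b : ℝ) (_ : a ∈ I) (_ : b ∈ I) (_ : a ≤ b), arcIntegralOn ρ γ a b

/-- `ρ` is admissible for a family of paths in the extended space: it is a nonnegative Borel
function on Euclidean space whose arc length integral is at least one on each locally rectifiable
path of the family. A path through `∞` is not locally rectifiable; any other one is given on its
parameter interval by a function `γ` into Euclidean space. -/
def Admissible {n : ℕ} (Γ : Set (PPath (OnePoint (Space n)))) (ρ : Space n → ℝ≥0∞) : Prop :=
  Measurable ρ ∧ ∀ p ∈ Γ, ∀ γ : ℝ → Space n,
    (∀ t ∈ p.dom, p.map t = (γ t : OnePoint (Space n))) →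
    LocallyBoundedVariationOn γ p.dom → 1 ≤ arcIntegral ρ γ p.dom

/-- The (conformal) modulus of a family of paths in the extended space. -/
def modulus {n : ℕ} (Γ : Set (PPath (OnePoint (Space n)))) : ℝ≥0∞ :=
  ⨅ (ρ : Space n → ℝ≥0∞) (_ : Admissible Γ ρ), ∫⁻ x, ρ x ^ n

/-- `Γ(E, F, D)`: paths `γ` on `[0, 1]` with `γ 0 ∈ E`, `γ 1 ∈ F` and `γ t ∈ D` for
`0 < t < 1`. -/
def joiningPaths {X : Type*} [TopologicalSpace X] (E F D : Set X) : Set (ℝ → X) :=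
  {γ | ContinuousOn γ (Icc 0 1) ∧ γ 0 ∈ E ∧ γ 1 ∈ F ∧ ∀ t ∈ Ioo (0 : ℝ) 1, γ t ∈ D}

/-- The image `f(Γ)` of a family of paths on `[0, 1]` under a map `f` defined on `D`: each `f ∘ γ`
is taken on the set of parameters where it is defined. For `γ ∈ Γ(E, F, D)` this is an interval
which contains `(0, 1)`, and contains `0` (or `1`) if and only if that end of `γ` is in `D`. -/
def imagePaths {X Y : Type*} {D : Set X} (f : D → Y) (Γ : Set (ℝ → X)) : Set (PPath Y) :=
  {p | ∃ γ ∈ Γ, p.dom = {t ∈ Icc (0 : ℝ) 1 | γ t ∈ D} ∧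
    ∀ t ∈ p.dom, ∀ h : γ t ∈ D, p.map t = f ⟨γ t, h⟩}

/-- The open spherical ring `A(x₀, r₁, r₂)`. -/
def openRing {n : ℕ} (x₀ : Space n) (r₁ r₂ : ℝ) : Set (Space n) :=
  {x | r₁ < ‖x - x₀‖ ∧ ‖x - x₀‖ < r₂}

/-- `f : D → ℝⁿ ∪ {∞}` is a ring `Q`-mapping at the (finite) point `x₀`. -/
def IsRingMapAt {n : ℕ} {D : Set (Space n)} (Q : Space n → ℝ≥0∞)
    (f : D → OnePoint (Space n)) (x₀ : Space n) : Prop :=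
  ∀ r₁ r₂ : ℝ, 0 < r₁ → r₁ < r₂ → ENNReal.ofReal r₂ < ⨆ x ∈ D, edist x x₀ →
    ∀ η : ℝ → ℝ≥0∞, AEMeasurable η (volume.restrict (Ioo r₁ r₂)) →
      1 ≤ ∫⁻ r in Ioo r₁ r₂, η r →
      modulus (imagePaths f (joiningPaths (Metric.sphere x₀ r₁) (Metric.sphere x₀ r₂) D)) ≤
        ∫⁻ x in openRing x₀ r₁ r₂ ∩ D, Q x * η ‖x - x₀‖ ^ n

/-- The family `R_Q(D, D')` of all homeomorphisms `g` of `D'` onto `D` such that `f = g⁻¹` is a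
ring `Q`-mapping (hence a ring `Q`-homeomorphism) at each point of `D`. -/
def ringFamily {n : ℕ} (Q : Space n → ℝ≥0∞) (D : Set (Space n))
    (D' : Set (OnePoint (Space n))) : Set (D' ≃ₜ D) :=
  {g | ∀ x₀ ∈ D, IsRingMapAt Q (fun x : D => (g.symm x : OnePoint (Space n))) x₀}

/-- Equicontinuity at a point of a family of maps between sets with distance functions. -/
def EquicontAt {X' X : Type*} (d' : X' → X' → ℝ) (d : X → X → ℝ) (G : Set (X' → X))
    (y₀ : X') : Prop :=
  ∀ ε > 0, ∃ δ > 0, ∀ g ∈ G, ∀ y : X', d' y y₀ < δ → d (g y) (g y₀) < ε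

/-- Equicontinuity of a family of maps between sets with distance functions. -/
def Equicont {X' X : Type*} (d' : X' → X' → ℝ) (d : X → X → ℝ) (G : Set (X' → X)) : Prop :=
  ∀ y₀ : X', EquicontAt d' d G y₀

end RingHomeo

end

/-!
Fix `ε > 0`. The domain `D` is covered by finitely many balls of radius `ε / 8` centred in `D`. For
each centre `k` the ring `Q`-inequality with a constant `η` bounds the modulus of the images of the
paths in `D` joining the spheres of radii `ε / 8` and `ε / 4` about `k` by a constant multiple of
`∫ Q`. Combining almost extremal densities for these finitely many families gives, for each
`g ∈ ringFamily Q D D'`, one density `ρ` with `∫ ρ ^ n` bounded independently of `g`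
(`exists_uniform_density`) and with `∫ ρ ds ≥ 1` along every path in `D'` whose preimage joins two
points of `D` at distance at least `ε` (`one_le_lintegral_of_far`), since such a preimage crosses
one of these rings.

Suppose that `y` is close to `y₀` but `|g y - g y₀| ≥ ε`. The rays from `g y` and `g y₀` pointing
away from each other leave every `g(U)`, where `U` is a neighbourhood of `y₀` and `y` with closure
in `D'`; points of different rays are at distance at least `ε` (`exists_pair_dist_ge`). So each
sphere that separates `{y, y₀}` from the boundary of a fixed neighbourhood of `y₀` carries two
points whose preimages are at distance at least `ε`, and `ρ` has integral at least one along all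
paths on the sphere between them. On a sphere of radius `r` this forces `∫ ρ ^ n ≥ c / r`
(`sphere_lower_bound`), and integrating over `r` gives `∫ ρ ^ n ≥ c log (r₂ / r₁)`
(`ring_lower_bound`), where `r₁` and `r₂` are the extreme radii. As `y → y₀` the ratio `r₂ / r₁`
tends to infinity, which contradicts the uniform bound. For `y₀ = ∞` the spheres are centred at the
origin.

The estimate on a sphere is of Morrey type. Two points `a` and `b` of the unit sphere are joined by
the radial projections of the broken lines `a → w → b`, where `w` runs through a ball about a unit
vector that makes equal angles, at most right, with `a` and `b`. Averaging over `w` bounds a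
constant by integrals of the radial extension of `ρ` over balls of radius `s / 4` about points of
two segments, `0 < s ≤ 1`. Because that extension is constant on rays, the integral of its `n`-th
power over such a ball is `O(s)` times the integral over the sphere, and the remaining singularity
`s ^ (-1 + 1 / n)` is integrable.
-/

namespace RingHomeo

open scoped NNReal

/-! ### Arc length integrals over Lipschitz paths -/

theorem setLIntegral_image_le_of_lipschitzOnWith {v : ℝ → ℝ} {L : ℝ≥0} {s : Set ℝ}
    (hs : MeasurableSet s) (hv : LipschitzOnWith L v s) (φ : ℝ → ℝ≥0∞) :
    ∫⁻ x in v '' s, φ x ≤ L * ∫⁻ t in s, φ (v t) := by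
  have hm : AEMeasurable v (volume.restrict s) := hv.continuousOn.aemeasurable hs
  have key : volume.restrict (v '' s) ≤ (L : ℝ≥0∞) • (volume.restrict s).map v := by
    refine Measure.le_iff.2 fun u hu => ?_
    rw [Measure.restrict_apply hu, Measure.smul_apply, Measure.map_apply_of_aemeasurable hm hu,
      Measure.restrict_apply' hs, smul_eq_mul]
    have h1 : u ∩ v '' s ⊆ v '' (v ⁻¹' u ∩ s) := by
      rintro _ ⟨hx, t, ht, rfl⟩
      exact ⟨t, ⟨hx, ht⟩, rfl⟩
    have h2 := (hv.mono (inter_subset_right (s := v ⁻¹' u))).hausdorffMeasure_image_le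
      (d := 1) zero_le_one
    rw [hausdorffMeasure_real, ENNReal.rpow_one] at h2
    exact (measure_mono h1).trans h2
  calc ∫⁻ x in v '' s, φ x ≤ ∫⁻ x, φ x ∂((L : ℝ≥0∞) • (volume.restrict s).map v) :=
        lintegral_mono' key (le_refl φ)
    _ = L * ∫⁻ x, φ x ∂((volume.restrict s).map v) := by rw [lintegral_smul_measure, smul_eq_mul]
    _ ≤ L * ∫⁻ t in s, φ (v t) := mul_le_mul' le_rfl (lintegral_map_le φ v)

theorem lipschitzOnWith_variationOnFromTo {n : ℕ} {γ : ℝ → Space n} {L : ℝ≥0} {a b : ℝ}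
    (hab : a ≤ b) (hγ : LipschitzOnWith L γ (Icc a b)) :
    LipschitzOnWith L (variationOnFromTo γ (Icc a b) a) (Icc a b) := by
  have hbv : LocallyBoundedVariationOn γ (Icc a b) := hγ.locallyBoundedVariationOn
  have ha : a ∈ Icc a b := left_mem_Icc.2 hab
  refine LipschitzOnWith.of_le_add_mul L fun x hx y hy => ?_
  have hadd := variationOnFromTo.add hbv ha hy hx
  suffices variationOnFromTo γ (Icc a b) y x ≤ L * dist x y by linarith
  rcases le_total x y with h | h
  · exact (variationOnFromTo.nonpos_of_ge γ _ h).trans (by positivity)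
  · rw [variationOnFromTo.eq_of_le _ _ h]
    have h1 : eVariationOn γ (Icc a b ∩ Icc y x) ≤ L * eVariationOn id (Icc y x) := by
      have := (hγ.mono (inter_subset_left (t := Icc y x))).comp_eVariationOn_le
        (f := γ) (g := (id : ℝ → ℝ)) (s := Icc a b ∩ Icc y x) (fun t ht => ht)
      refine this.trans ?_
      gcongr
      exact eVariationOn.mono _ inter_subset_right
    rw [eVariationOn_id_Icc] at h1
    rw [Real.dist_eq, abs_of_nonneg (sub_nonneg.2 h)]
    refine ENNReal.toReal_le_of_le_ofReal (mul_nonneg L.2 (sub_nonneg.2 h)) (h1.trans_eq ?_)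
    rw [ENNReal.ofReal_mul (p := (L : ℝ)) L.2, ENNReal.ofReal_coe_nnreal]

/-- The arc length integral is computed in the arc length parameter; the arc length is an
`L`-Lipschitz function of the original parameter, so passing to the latter costs a factor `L`. -/
theorem arcIntegralOn_le {n : ℕ} (ρ : Space n → ℝ≥0∞) {γ : ℝ → Space n} {L : ℝ≥0} {a b : ℝ}
    (hab : a ≤ b) (hγ : LipschitzOnWith L γ (Icc a b)) :
    arcIntegralOn ρ γ a b ≤ L * ∫⁻ t in Icc a b, ρ (γ t) := by
  have hbv : LocallyBoundedVariationOn γ (Icc a b) := hγ.locallyBoundedVariationOn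
  have ha : a ∈ Icc a b := left_mem_Icc.2 hab
  set v := variationOnFromTo γ (Icc a b) a with hv
  have hvL : LipschitzOnWith L v (Icc a b) := lipschitzOnWith_variationOnFromTo hab hγ
  have hsub : Icc (0 : ℝ) (eVariationOn γ (Icc a b)).toReal ⊆ v '' Icc a b := by
    have h := intermediate_value_Icc hab hvL.continuousOn
    rwa [hv, variationOnFromTo.self, variationOnFromTo.eq_of_le _ _ hab, inter_self] at h
  calc arcIntegralOn ρ γ a b
      ≤ ∫⁻ s in v '' Icc a b, ρ (naturalParameterization γ (Icc a b) a s) :=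
        lintegral_mono_set hsub
    _ ≤ L * ∫⁻ t in Icc a b, ρ (naturalParameterization γ (Icc a b) a (v t)) :=
        setLIntegral_image_le_of_lipschitzOnWith measurableSet_Icc hvL _
    _ = L * ∫⁻ t in Icc a b, ρ (γ t) := by
        congr 1
        refine setLIntegral_congr_fun measurableSet_Icc fun t ht => ?_
        have := edist_naturalParameterization_eq_zero hbv ha ht
        exact congrArg ρ (edist_eq_zero.1 this)

theorem arcIntegral_Icc_le {n : ℕ} (ρ : Space n → ℝ≥0∞) {γ : ℝ → Space n} {L : ℝ≥0} {a b : ℝ}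
    (hγ : LipschitzOnWith L γ (Icc a b)) :
    arcIntegral ρ γ (Icc a b) ≤ L * ∫⁻ t in Icc a b, ρ (γ t) := by
  refine iSup_le fun c => iSup_le fun d => iSup_le fun hc => iSup_le fun hd => iSup_le fun hcd => ?_
  have hsub : Icc c d ⊆ Icc a b := Icc_subset_Icc hc.1 hd.2
  refine (arcIntegralOn_le ρ hcd (hγ.mono hsub)).trans ?_
  gcongr

/-- The affine reparametrization of `[t₁, t₂]` by `[0, 1]`. -/
theorem arcIntegral_comp_affine_le {n : ℕ} (ρ : Space n → ℝ≥0∞) {σ : ℝ → Space n} {L : ℝ≥0}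
    {t₁ t₂ : ℝ} (ht : t₁ < t₂) (hσ : LipschitzOnWith L σ (Icc t₁ t₂)) :
    LipschitzOnWith (L * ⟨t₂ - t₁, (sub_pos.2 ht).le⟩)
        (fun t => σ (t₁ + t * (t₂ - t₁))) (Icc 0 1) ∧
      arcIntegral ρ (fun t => σ (t₁ + t * (t₂ - t₁))) (Icc 0 1) ≤
        L * ∫⁻ t in Icc t₁ t₂, ρ (σ t) := by
  have hpos : 0 < t₂ - t₁ := sub_pos.2 ht
  set d : ℝ≥0 := ⟨t₂ - t₁, hpos.le⟩ with hd
  have hd0 : d ≠ 0 := fun h => hpos.ne' (congrArg NNReal.toReal h)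
  have hmaps : MapsTo (fun t : ℝ => t₁ + t * (t₂ - t₁)) (Icc 0 1) (Icc t₁ t₂) := by
    intro t ht'
    constructor <;> nlinarith [ht'.1, ht'.2]
  have hlip : LipschitzOnWith d (fun t : ℝ => t₁ + t * (t₂ - t₁)) (Icc 0 1) := by
    refine LipschitzOnWith.of_dist_le_mul fun x _ y _ => le_of_eq ?_
    rw [Real.dist_eq, Real.dist_eq, show (d : ℝ) = t₂ - t₁ from rfl, ← abs_of_pos hpos, ← abs_mul,
      abs_of_pos hpos]
    congr 1; ring
  have hcomp := hσ.comp hlip hmaps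
  refine ⟨hcomp, (arcIntegral_Icc_le ρ hcomp).trans ?_⟩
  have himg : (fun t : ℝ => (t - t₁) / (t₂ - t₁)) '' Icc t₁ t₂ = Icc 0 1 := by
    ext s
    constructor
    · rintro ⟨t, ht', rfl⟩
      exact ⟨div_nonneg (by linarith [ht'.1]) hpos.le, (div_le_one hpos).2 (by linarith [ht'.2])⟩
    · intro hs
      exact ⟨t₁ + s * (t₂ - t₁), hmaps hs, by simp [hpos.ne']⟩
  have hlip' : LipschitzOnWith d⁻¹ (fun t : ℝ => (t - t₁) / (t₂ - t₁)) (Icc t₁ t₂) := by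
    refine LipschitzOnWith.of_dist_le_mul fun x _ y _ => le_of_eq ?_
    rw [Real.dist_eq, Real.dist_eq, NNReal.coe_inv, show (d : ℝ) = t₂ - t₁ from rfl, ← sub_div,
      abs_div, abs_of_pos hpos, div_eq_inv_mul]
    congr 2; ring
  have hint := setLIntegral_image_le_of_lipschitzOnWith measurableSet_Icc hlip'
    (fun t => ρ (σ (t₁ + t * (t₂ - t₁))))
  rw [himg] at hint
  calc ((L * d : ℝ≥0) : ℝ≥0∞) * ∫⁻ t in Icc (0 : ℝ) 1, ρ (σ (t₁ + t * (t₂ - t₁)))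
      ≤ ((L * d : ℝ≥0) : ℝ≥0∞) * ((d⁻¹ : ℝ≥0) * ∫⁻ t in Icc t₁ t₂,
          ρ (σ (t₁ + (t - t₁) / (t₂ - t₁) * (t₂ - t₁)))) := by gcongr
    _ = L * ∫⁻ t in Icc t₁ t₂, ρ (σ t) := by
        rw [← mul_assoc, ← ENNReal.coe_mul, mul_assoc, mul_inv_cancel₀ hd0, mul_one]
        congr 2
        funext t
        rw [div_mul_cancel₀ _ hpos.ne', add_sub_cancel]

/-! ### Polar coordinates -/

/-- Integration in polar coordinates, for nonnegative functions. -/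
theorem lintegral_eq_lintegral_sphere {n : ℕ} (hn : 2 ≤ n) {F : Space n → ℝ≥0∞}
    (hF : Measurable F) :
    ∫⁻ x, F x = ∫⁻ r in Ioi (0 : ℝ), ENNReal.ofReal (r ^ (n - 1)) *
      ∫⁻ θ, F (r • (θ : Space n)) ∂(volume : Measure (Space n)).toSphere := by
  have : Nonempty (Fin n) := ⟨⟨0, by omega⟩⟩
  have hfin : Module.finrank ℝ (Space n) = n := by simp
  have hmp := (volume : Measure (Space n)).measurePreserving_homeomorphUnitSphereProd
  rw [hfin] at hmp
  have h1 : ∫⁻ x, F x = ∫⁻ x : ({0}ᶜ : Set (Space n)), F x ∂(volume.comap Subtype.val) := by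
    rw [lintegral_subtype_comap (measurableSet_singleton _).compl]
    rw [restrict_compl_singleton]
  have h2 : ∀ x : ({0}ᶜ : Set (Space n)), F x =
      (fun p : Metric.sphere (0 : Space n) 1 × Ioi (0 : ℝ) => F ((p.2 : ℝ) • (p.1 : Space n)))
        (homeomorphUnitSphereProd (Space n) x) := by
    intro x
    have hx : ‖(x : Space n)‖ ≠ 0 := norm_ne_zero_iff.2 x.2
    simp [smul_smul, hx]
  have hm : Measurable (fun p : Metric.sphere (0 : Space n) 1 × Ioi (0 : ℝ) =>
      F ((p.2 : ℝ) • (p.1 : Space n))) := by fun_prop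
  rw [h1, lintegral_congr h2, hmp.lintegral_comp hm, lintegral_prod_symm' _ hm,
    Measure.volumeIoiPow, lintegral_withDensity_eq_lintegral_mul _ (by fun_prop)
      hm.lintegral_prod_left', ← lintegral_subtype_comap measurableSet_Ioi]
  rfl

/-! ### Paths on the unit sphere through an auxiliary point -/

theorem exists_norm_one_inner_eq {n : ℕ} (hn : 2 ≤ n) (a b : Space n) :
    ∃ q : Space n, ‖q‖ = 1 ∧ inner ℝ a q = inner ℝ b q ∧ 0 ≤ inner ℝ a q := by
  have hne : (ℝ ∙ (a - b))ᗮ ≠ ⊥ := by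
    intro h
    have h1 := Submodule.finrank_add_finrank_orthogonal (ℝ ∙ (a - b))
    rw [h, finrank_bot, finrank_euclideanSpace_fin] at h1
    have h2 : Module.finrank ℝ (ℝ ∙ (a - b)) ≤ 1 := by
      simpa using finrank_span_le_card (R := ℝ) ({a - b} : Set (Space n))
    omega
  obtain ⟨v, hv, hv0⟩ := Submodule.exists_mem_ne_zero_of_ne_bot hne
  have hperp : inner ℝ a v = inner ℝ b v := by
    have := Submodule.mem_orthogonal_singleton_iff_inner_right.1 hv
    rwa [inner_sub_left, sub_eq_zero] at this
  have hpos : 0 < ‖v‖ := norm_pos_iff.2 hv0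
  rcases le_total 0 (inner ℝ a v) with h | h
  · refine ⟨‖v‖⁻¹ • v, by simp [norm_smul, hpos.ne'], ?_, ?_⟩
    · simp only [inner_smul_right, hperp]
    · rw [inner_smul_right]; positivity
  · refine ⟨-(‖v‖⁻¹ • v), by simp [norm_smul, hpos.ne'], ?_, ?_⟩
    · simp only [inner_neg_right, inner_smul_right, hperp]
    · rw [inner_neg_right, inner_smul_right]
      have : 0 ≤ ‖v‖⁻¹ := by positivity
      nlinarith

/-- The segment from a unit vector `e` to a point near a unit vector `q` at a right or acute angle
to `e` stays away from the origin. -/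
theorem segment_norm_bounds {n : ℕ} {e q w : Space n} (he : ‖e‖ = 1) (hq : ‖q‖ = 1)
    (heq : 0 ≤ inner ℝ e q) (hw : ‖w - q‖ < 1 / 4) {s : ℝ} (hs : s ∈ Icc (0 : ℝ) 1) :
    |‖e + s • (w - e)‖ - ‖e + s • (q - e)‖| ≤ s / 4 ∧ ‖e + s • (q - e)‖ ≤ 1 ∧
      9 / 20 ≤ ‖e + s • (w - e)‖ := by
  have h1 : |‖e + s • (w - e)‖ - ‖e + s • (q - e)‖| ≤ s / 4 := by
    refine (abs_norm_sub_norm_le _ _).trans ?_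
    rw [show e + s • (w - e) - (e + s • (q - e)) = s • (w - q) by module, norm_smul,
      Real.norm_eq_abs, abs_of_nonneg hs.1]
    nlinarith [hs.1]
  have hexp : ‖e + s • (q - e)‖ ^ 2 = (1 - s) ^ 2 + 2 * (s * (1 - s)) * inner ℝ e q + s ^ 2 := by
    rw [show e + s • (q - e) = (1 - s) • e + s • q by module, norm_add_sq_real, norm_smul,
      norm_smul, he, hq, inner_smul_left, inner_smul_right]
    simp only [Real.norm_eq_abs, mul_one, sq_abs, conj_trivial]
    ring
  have hss : 0 ≤ s * (1 - s) := mul_nonneg hs.1 (sub_nonneg.2 hs.2)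
  have hle : inner ℝ e q ≤ 1 := by
    have := real_inner_le_norm e q
    rwa [he, hq, one_mul] at this
  have h2 : ‖e + s • (q - e)‖ ≤ 1 := by
    refine abs_le_one_iff_mul_self_le_one.2 ?_ |> (le_abs_self _).trans
    nlinarith [mul_le_mul_of_nonneg_left hle hss]
  have h3 : (7 / 10 : ℝ) ≤ ‖e + s • (q - e)‖ := by
    refine le_of_sq_le_sq ?_ (norm_nonneg _)
    rw [hexp]
    nlinarith [mul_nonneg hss heq, sq_nonneg (2 * s - 1)]
  refine ⟨h1, h2, ?_⟩
  have := (abs_le.1 h1).1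
  linarith [hs.2]

theorem lipschitzOnWith_normalize {n : ℕ} :
    LipschitzOnWith (40 / 9) (fun x : Space n => ‖x‖⁻¹ • x) {x | 9 / 20 ≤ ‖x‖} := by
  refine LipschitzOnWith.of_dist_le_mul fun x hx y hy => ?_
  have hx' : (9 / 20 : ℝ) ≤ ‖x‖ := hx
  have hy' : (9 / 20 : ℝ) ≤ ‖y‖ := hy
  have hx0 : 0 < ‖x‖ := by linarith
  have hy0 : 0 < ‖y‖ := by linarith
  rw [dist_eq_norm, dist_eq_norm]
  have hid : ‖x‖⁻¹ • x - ‖y‖⁻¹ • y = ‖x‖⁻¹ • ((x - y) + (‖y‖ - ‖x‖) • (‖y‖⁻¹ • y)) := by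
    rw [smul_add, smul_smul, smul_smul, smul_sub]
    have : ‖x‖⁻¹ * (‖y‖ - ‖x‖) * ‖y‖⁻¹ = ‖x‖⁻¹ - ‖y‖⁻¹ := by field_simp
    rw [this, sub_smul]
    abel
  rw [hid, norm_smul, norm_inv, norm_norm]
  have hb : ‖(x - y) + (‖y‖ - ‖x‖) • (‖y‖⁻¹ • y)‖ ≤ 2 * ‖x - y‖ := by
    refine (norm_add_le _ _).trans ?_
    rw [norm_smul, norm_smul, norm_inv, norm_norm, inv_mul_cancel₀ hy0.ne', mul_one,
      Real.norm_eq_abs]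
    have := abs_norm_sub_norm_le y x
    rw [norm_sub_rev] at this
    linarith
  have hinv : ‖x‖⁻¹ ≤ 20 / 9 := by
    rw [inv_le_comm₀ hx0 (by norm_num)]; linarith
  calc ‖x‖⁻¹ * ‖(x - y) + (‖y‖ - ‖x‖) • (‖y‖⁻¹ • y)‖ ≤ 20 / 9 * (2 * ‖x - y‖) := by gcongr
    _ = ((40 / 9 : ℝ≥0) : ℝ) * ‖x - y‖ := by push_cast; ring

/-- The radial projection to the unit sphere of the broken line `a → w → b`, on `[-1, 1]`. -/
noncomputable def brokenArc {n : ℕ} (a w b : Space n) (t : ℝ) : Space n :=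
  ‖w + max t 0 • (b - w) + max (-t) 0 • (a - w)‖⁻¹ •
    (w + max t 0 • (b - w) + max (-t) 0 • (a - w))

theorem brokenArc_of_nonneg {n : ℕ} (a w b : Space n) {t : ℝ} (ht : 0 ≤ t) :
    brokenArc a w b t = ‖b + (1 - t) • (w - b)‖⁻¹ • (b + (1 - t) • (w - b)) := by
  rw [brokenArc, max_eq_left ht, max_eq_right (neg_nonpos.2 ht)]
  rw [show w + t • (b - w) + (0 : ℝ) • (a - w) = b + (1 - t) • (w - b) by module]

theorem brokenArc_of_nonpos {n : ℕ} (a w b : Space n) {t : ℝ} (ht : t ≤ 0) :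
    brokenArc a w b t = ‖a + (1 + t) • (w - a)‖⁻¹ • (a + (1 + t) • (w - a)) := by
  rw [brokenArc, max_eq_right ht, max_eq_left (neg_nonneg.2 ht)]
  rw [show w + (0 : ℝ) • (b - w) + (-t) • (a - w) = a + (1 + t) • (w - a) by module]

/-- The properties of `brokenArc` when `w` is close to a unit vector `q` at right or acute angles
to the unit vectors `a` and `b`. -/
theorem brokenArc_properties {n : ℕ} {a b q w : Space n} (ha : ‖a‖ = 1) (hb : ‖b‖ = 1)
    (hq : ‖q‖ = 1) (haq : 0 ≤ inner ℝ a q) (hbq : 0 ≤ inner ℝ b q) (hw : ‖w - q‖ < 1 / 4) :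
    LipschitzOnWith 20 (brokenArc a w b) (Icc (-1) 1) ∧
      (∀ t ∈ Icc (-1 : ℝ) 1, ‖brokenArc a w b t‖ = 1) ∧
      brokenArc a w b (-1) = a ∧ brokenArc a w b 1 = b := by
  set l : ℝ → Space n := fun t => w + max t 0 • (b - w) + max (-t) 0 • (a - w) with hl
  have hlb : ∀ t ∈ Icc (-1 : ℝ) 1, 9 / 20 ≤ ‖l t‖ := by
    intro t ht
    rcases le_total 0 t with h | h
    · have := (segment_norm_bounds hb hq hbq hw (s := 1 - t)
        ⟨by linarith [ht.2], by linarith⟩).2.2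
      rw [hl]
      simp only [max_eq_left h, max_eq_right (neg_nonpos.2 h)]
      rwa [show w + t • (b - w) + (0 : ℝ) • (a - w) = b + (1 - t) • (w - b) by module]
    · have := (segment_norm_bounds ha hq haq hw (s := 1 + t)
        ⟨by linarith [ht.1], by linarith⟩).2.2
      rw [hl]
      simp only [max_eq_right h, max_eq_left (neg_nonneg.2 h)]
      rwa [show w + (0 : ℝ) • (b - w) + (-t) • (a - w) = a + (1 + t) • (w - a) by module]
  have hwn : ‖w‖ ≤ 5 / 4 := by
    have := norm_le_norm_add_norm_sub' w q
    rw [hq] at this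
    linarith
  have hlip : LipschitzOnWith (9 / 2) l (Icc (-1) 1) := by
    refine LipschitzOnWith.of_dist_le_mul fun x _ y _ => ?_
    rw [dist_eq_norm, hl]
    have h1 : |max x 0 - max y 0| ≤ |x - y| := by
      simpa using abs_max_sub_max_le_abs x y 0
    have h2 : |max (-x) 0 - max (-y) 0| ≤ |x - y| := by
      have := abs_max_sub_max_le_abs (-x) (-y) 0
      rwa [show -x - -y = -(x - y) by ring, abs_neg] at this
    have h3 : ‖b - w‖ ≤ 9 / 4 := (norm_sub_le _ _).trans (by linarith)
    have h4 : ‖a - w‖ ≤ 9 / 4 := (norm_sub_le _ _).trans (by linarith)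
    calc ‖w + max x 0 • (b - w) + max (-x) 0 • (a - w) -
          (w + max y 0 • (b - w) + max (-y) 0 • (a - w))‖
        = ‖(max x 0 - max y 0) • (b - w) + (max (-x) 0 - max (-y) 0) • (a - w)‖ := by
          congr 1; module
      _ ≤ |max x 0 - max y 0| * ‖b - w‖ + |max (-x) 0 - max (-y) 0| * ‖a - w‖ := by
          refine (norm_add_le _ _).trans_eq ?_
          rw [norm_smul, norm_smul, Real.norm_eq_abs, Real.norm_eq_abs]
      _ ≤ |x - y| * (9 / 4) + |x - y| * (9 / 4) := by gcongr
      _ = ((9 / 2 : ℝ≥0) : ℝ) * dist x y := by rw [Real.dist_eq]; push_cast; ring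
  refine ⟨?_, ?_, ?_, ?_⟩
  · have := lipschitzOnWith_normalize.comp hlip (fun t ht => hlb t ht)
    rwa [show (40 / 9 * (9 / 2) : ℝ≥0) = 20 by
      rw [← NNReal.coe_inj]; push_cast; norm_num] at this
  · intro t ht
    have h0 : ‖l t‖ ≠ 0 := by linarith [hlb t ht]
    change ‖‖l t‖⁻¹ • l t‖ = 1
    rw [norm_smul, norm_inv, norm_norm, inv_mul_cancel₀ h0]
  · rw [brokenArc_of_nonpos _ _ _ (by norm_num)]; simp [ha]
  · rw [brokenArc_of_nonneg _ _ _ (by norm_num)]; simp [hb]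

/-! ### A Morrey type estimate on the sphere -/

/-- The extension of a function on the unit sphere which is constant on rays from the origin; its
value at the origin is irrelevant. -/
noncomputable def radialExt {n : ℕ} (ψ : Space n → ℝ≥0∞) (x : Space n) : ℝ≥0∞ :=
  ψ (‖x‖⁻¹ • x)

theorem measurable_radialExt {n : ℕ} {ψ : Space n → ℝ≥0∞} (hψ : Measurable ψ) :
    Measurable (radialExt ψ) :=
  hψ.comp (by fun_prop)

theorem lintegral_brokenArc_le {n : ℕ} (ψ : Space n → ℝ≥0∞) (a w b : Space n) :
    ∫⁻ t in Icc (-1 : ℝ) 1, ψ (brokenArc a w b t) ≤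
      (∫⁻ s in Icc (0 : ℝ) 1, radialExt ψ (a + s • (w - a))) +
        ∫⁻ s in Icc (0 : ℝ) 1, radialExt ψ (b + s • (w - b)) := by
  have h1 : ∫⁻ t in Icc (-1 : ℝ) 0, ψ (brokenArc a w b t) ≤
      ∫⁻ s in Icc (0 : ℝ) 1, radialExt ψ (a + s • (w - a)) := by
    have himg : (fun s : ℝ => s - 1) '' Icc 0 1 = Icc (-1) 0 := by
      rw [image_sub_const_Icc]; norm_num
    have hl : LipschitzOnWith 1 (fun s : ℝ => s - 1) (Icc 0 1) :=
      LipschitzOnWith.of_dist_le_mul fun x _ y _ => by simp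
    have := setLIntegral_image_le_of_lipschitzOnWith measurableSet_Icc hl
      (fun t => ψ (brokenArc a w b t))
    rw [himg, ENNReal.coe_one, one_mul] at this
    refine this.trans_eq (setLIntegral_congr_fun measurableSet_Icc fun s hs => ?_)
    simp only [radialExt]
    rw [brokenArc_of_nonpos _ _ _ (by linarith [hs.2]), add_sub_cancel]
  have h2 : ∫⁻ t in Icc (0 : ℝ) 1, ψ (brokenArc a w b t) ≤
      ∫⁻ s in Icc (0 : ℝ) 1, radialExt ψ (b + s • (w - b)) := by
    have himg : (fun s : ℝ => 1 - s) '' Icc 0 1 = Icc 0 1 := by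
      rw [image_const_sub_Icc]; norm_num
    have hl : LipschitzOnWith 1 (fun s : ℝ => 1 - s) (Icc 0 1) :=
      LipschitzOnWith.of_dist_le_mul fun x _ y _ => by
        rw [Real.dist_eq, sub_sub_sub_cancel_left, abs_sub_comm, ← Real.dist_eq]; simp
    have := setLIntegral_image_le_of_lipschitzOnWith measurableSet_Icc hl
      (fun t => ψ (brokenArc a w b t))
    rw [himg, ENNReal.coe_one, one_mul] at this
    refine this.trans_eq (setLIntegral_congr_fun measurableSet_Icc fun s hs => ?_)
    simp only [radialExt]
    rw [brokenArc_of_nonneg _ _ _ (by linarith [hs.2]), sub_sub_cancel]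
  rw [← Icc_union_Icc_eq_Icc (show (-1 : ℝ) ≤ 0 by norm_num) zero_le_one]
  exact (lintegral_union_le _ _ _).trans (add_le_add h1 h2)

theorem lintegral_comp_homothety {n : ℕ} (F : Space n → ℝ≥0∞) (hF : Measurable F)
    (e : Space n) {s : ℝ} (hs : 0 < s) :
    ∫⁻ w, F (e + s • (w - e)) = ENNReal.ofReal (s ^ n)⁻¹ * ∫⁻ x, F x := by
  have h1 : ∀ w, F (e + s • (w - e)) = (fun x => F (x + (e - s • e))) (s • w) := by
    intro w
    simp only
    congr 1
    module
  have hm : Measurable fun x => F (x + (e - s • e)) := by fun_prop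
  rw [lintegral_congr h1, ← lintegral_map hm (measurable_const_smul s),
    Measure.map_addHaar_smul _ hs.ne', lintegral_smul_measure,
    lintegral_add_right_eq_self F (e - s • e), finrank_euclideanSpace_fin,
    abs_of_pos (by positivity), smul_eq_mul]

/-- The integral of the `n`-th power over the image of the ball `B(q, 1/4)` under the homothety with
centre `e` and ratio `s`: that image lies in a spherical ring of width `s / 2`, on which a function
that is constant on rays is integrated in polar coordinates. -/
theorem lintegral_radialExt_pow_le {n : ℕ} (hn : 2 ≤ n) {ψ : Space n → ℝ≥0∞} (hψ : Measurable ψ)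
    {e q : Space n} (he : ‖e‖ = 1) (hq : ‖q‖ = 1) (heq : 0 ≤ inner ℝ e q) {s : ℝ}
    (hs : s ∈ Ioc (0 : ℝ) 1) :
    ∫⁻ w in Metric.ball q (1 / 4), radialExt ψ (e + s • (w - e)) ^ n ≤
      ENNReal.ofReal (s⁻¹ ^ (n - 1)) *
        (2 ^ n * ∫⁻ θ, ψ (θ : Space n) ^ n ∂(volume : Measure (Space n)).toSphere) := by
  set G := ∫⁻ θ, ψ (θ : Space n) ^ n ∂(volume : Measure (Space n)).toSphere with hG
  set m := ‖e + s • (q - e)‖ with hm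
  set A : Set (Space n) := {x | |‖x‖ - m| ≤ s / 4} with hA
  have hAm : MeasurableSet A := measurableSet_le (by fun_prop) (by fun_prop)
  set F : Space n → ℝ≥0∞ := A.indicator fun x => radialExt ψ x ^ n with hF
  have hFm : Measurable F := ((measurable_radialExt hψ).pow_const n).indicator hAm
  have hs' : s ∈ Icc (0 : ℝ) 1 := ⟨hs.1.le, hs.2⟩
  have hm1 : m ≤ 1 := (segment_norm_bounds he hq heq (w := q) (by simp) hs').2.1
  have h1 : ∫⁻ w in Metric.ball q (1 / 4), radialExt ψ (e + s • (w - e)) ^ n ≤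
      ∫⁻ w, F (e + s • (w - e)) := by
    refine (setLIntegral_mono' measurableSet_ball fun w hw => ?_).trans
      (setLIntegral_le_lintegral (Metric.ball q (1 / 4)) _)
    have hw' : ‖w - q‖ < 1 / 4 := by rwa [← dist_eq_norm]
    have : e + s • (w - e) ∈ A := (segment_norm_bounds he hq heq hw' hs').1
    rw [hF, indicator_of_mem this]
  have h2 : ∫⁻ x, F x ≤ ENNReal.ofReal ((5 / 4) ^ (n - 1) * (s / 2)) * G := by
    rw [lintegral_eq_lintegral_sphere hn hFm]
    have hr : ∀ r ∈ Ioi (0 : ℝ), ENNReal.ofReal (r ^ (n - 1)) *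
        ∫⁻ θ, F (r • (θ : Space n)) ∂(volume : Measure (Space n)).toSphere ≤
        (Icc (m - s / 4) (m + s / 4)).indicator
          (fun _ => ENNReal.ofReal ((5 / 4) ^ (n - 1)) * G) r := by
      intro r hr
      have hr0 : (0 : ℝ) < r := hr
      have hnorm : ∀ θ : Metric.sphere (0 : Space n) 1, ‖r • (θ : Space n)‖ = r := by
        intro θ
        rw [norm_smul, norm_eq_of_mem_sphere, mul_one, Real.norm_of_nonneg hr0.le]
      by_cases hmem : r ∈ Icc (m - s / 4) (m + s / 4)
      · rw [indicator_of_mem hmem]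
        have hrle : r ≤ 5 / 4 := by linarith [hmem.2, hs.2]
        refine mul_le_mul' (ENNReal.ofReal_le_ofReal (by gcongr)) (lintegral_mono fun θ => ?_)
        refine (indicator_le_self _ _ _).trans_eq ?_
        rw [radialExt, hnorm, inv_smul_smul₀ hr0.ne']
      · rw [indicator_of_notMem hmem]
        refine le_of_eq ?_
        rw [mul_eq_zero]
        right
        rw [lintegral_eq_zero_iff (by fun_prop)]
        refine Filter.Eventually.of_forall fun θ => ?_
        refine indicator_of_notMem ?_ _
        rw [hA, mem_ofPred_eq, hnorm, abs_le]
        exact fun h => hmem ⟨by linarith [h.1], by linarith [h.2]⟩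
    refine (setLIntegral_mono' measurableSet_Ioi hr).trans ?_
    refine (setLIntegral_le_lintegral _ _).trans ?_
    rw [lintegral_indicator measurableSet_Icc, setLIntegral_const, Real.volume_Icc,
      ENNReal.ofReal_mul (by positivity)]
    rw [show m + s / 4 - (m - s / 4) = s / 2 by ring]
    exact le_of_eq (by ring)
  rw [lintegral_comp_homothety F hFm e hs.1] at h1
  refine h1.trans ((mul_le_mul' le_rfl h2).trans ?_)
  rw [← mul_assoc, ← mul_assoc, ← ENNReal.ofReal_mul (by have := hs.1; positivity)]
  refine mul_le_mul' ?_ le_rfl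
  have h22 : (2 : ℝ≥0∞) ^ n = ENNReal.ofReal (2 ^ n) := by
    rw [ENNReal.ofReal_pow (by norm_num)]; norm_num
  rw [h22, ← ENNReal.ofReal_mul (by have := hs.1; positivity)]
  refine ENNReal.ofReal_le_ofReal ?_
  obtain ⟨k, rfl⟩ : ∃ k, n = k + 1 := ⟨n - 1, by omega⟩
  have hs0 := hs.1
  have h54 : (5 / 4 : ℝ) ^ k ≤ 2 ^ (k + 1) := by
    calc (5 / 4 : ℝ) ^ k ≤ 2 ^ k := by gcongr; norm_num
      _ ≤ 2 ^ (k + 1) := by gcongr <;> norm_num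
  simp only [Nat.add_sub_cancel]
  calc (s ^ (k + 1))⁻¹ * ((5 / 4) ^ k * (s / 2)) = s⁻¹ ^ k * ((5 / 4) ^ k / 2) := by
        rw [pow_succ, inv_pow]; field_simp
    _ ≤ s⁻¹ ^ k * 2 ^ (k + 1) := by
        gcongr
        have : (0 : ℝ) ≤ (5 / 4) ^ k := by positivity
        linarith

/-- A weak form of Young's inequality. -/
theorem le_add_inv_pow_mul_pow {n : ℕ} (hn : 1 ≤ n) (x : ℝ≥0∞) {l : ℝ} (hl : 0 < l) :
    x ≤ ENNReal.ofReal l + ENNReal.ofReal (l⁻¹ ^ (n - 1)) * x ^ n := by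
  rcases le_total x (ENNReal.ofReal l) with h | h
  · exact h.trans le_self_add
  · refine le_trans ?_ le_add_self
    obtain ⟨k, rfl⟩ : ∃ k, n = k + 1 := ⟨n - 1, by omega⟩
    rw [Nat.add_sub_cancel, pow_succ, ← mul_assoc, ENNReal.ofReal_pow (by positivity), ← mul_pow,
      ENNReal.ofReal_inv_of_pos hl]
    have h0 : ENNReal.ofReal l ≠ 0 := by simpa using hl
    have h1 : 1 ≤ (ENNReal.ofReal l)⁻¹ * x := by
      rw [← ENNReal.inv_mul_cancel h0 ENNReal.ofReal_ne_top]
      gcongr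
    calc x = 1 * x := (one_mul x).symm
      _ ≤ _ := by gcongr; exact one_le_pow₀ h1

/-- The ball average along a homothety of ratio `s` has at most the integrable singularity
`s ^ (-1 + 1 / n)`. The splitting level in Young's inequality is a multiple of that power. -/
theorem lintegral_radialExt_le {n : ℕ} (hn : 2 ≤ n) {ψ : Space n → ℝ≥0∞} (hψ : Measurable ψ)
    {e q : Space n} (he : ‖e‖ = 1) (hq : ‖q‖ = 1) (heq : 0 ≤ inner ℝ e q) {s α : ℝ}
    (hs : s ∈ Ioc (0 : ℝ) 1) (hα : 0 < α) :
    ∫⁻ w in Metric.ball q (1 / 4), radialExt ψ (e + s • (w - e)) ≤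
      ENNReal.ofReal (s ^ (-1 + 1 / (n : ℝ))) *
        (ENNReal.ofReal α * volume (Metric.ball (0 : Space n) (1 / 4)) +
          ENNReal.ofReal (α⁻¹ ^ (n - 1)) *
        (2 ^ n * ∫⁻ θ, ψ (θ : Space n) ^ n ∂(volume : Measure (Space n)).toSphere)) := by
  set G := 2 ^ n * ∫⁻ θ, ψ (θ : Space n) ^ n ∂(volume : Measure (Space n)).toSphere with hG
  have hs0 := hs.1
  set β : ℝ := s ^ (-1 + 1 / (n : ℝ)) with hβ
  have hβ0 : 0 < β := Real.rpow_pos_of_pos hs0 _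
  have hn0 : (n : ℝ) ≠ 0 := by positivity
  have hreal : (α * β)⁻¹ ^ (n - 1) * s⁻¹ ^ (n - 1) = β * α⁻¹ ^ (n - 1) := by
    have h1 : (β⁻¹ * s⁻¹) ^ (n - 1) = β := by
      rw [hβ, ← Real.rpow_neg hs0.le, ← Real.rpow_neg_one s, ← Real.rpow_add hs0,
        ← Real.rpow_natCast, ← Real.rpow_mul hs0.le, Nat.cast_sub (by omega)]
      congr 1
      field_simp
      push_cast
      ring
    calc (α * β)⁻¹ ^ (n - 1) * s⁻¹ ^ (n - 1) = α⁻¹ ^ (n - 1) * (β⁻¹ * s⁻¹) ^ (n - 1) := by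
          rw [mul_inv, mul_pow, mul_pow]; ring
      _ = _ := by rw [h1, mul_comm]
  calc ∫⁻ w in Metric.ball q (1 / 4), radialExt ψ (e + s • (w - e))
      ≤ ∫⁻ w in Metric.ball q (1 / 4), (ENNReal.ofReal (α * β) +
          ENNReal.ofReal ((α * β)⁻¹ ^ (n - 1)) * radialExt ψ (e + s • (w - e)) ^ n) :=
        lintegral_mono fun w => le_add_inv_pow_mul_pow (by omega) _ (by positivity)
    _ = ENNReal.ofReal (α * β) * volume (Metric.ball (0 : Space n) (1 / 4)) +
          ENNReal.ofReal ((α * β)⁻¹ ^ (n - 1)) *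
            ∫⁻ w in Metric.ball q (1 / 4), radialExt ψ (e + s • (w - e)) ^ n := by
        rw [lintegral_add_left measurable_const, setLIntegral_const,
          lintegral_const_mul' _ _ ENNReal.ofReal_ne_top, Measure.addHaar_ball_center]
    _ ≤ ENNReal.ofReal (α * β) * volume (Metric.ball (0 : Space n) (1 / 4)) +
          ENNReal.ofReal ((α * β)⁻¹ ^ (n - 1)) * (ENNReal.ofReal (s⁻¹ ^ (n - 1)) * G) := by
        gcongr
        exact lintegral_radialExt_pow_le hn hψ he hq heq hs
    _ = _ := by
        rw [← mul_assoc (ENNReal.ofReal ((α * β)⁻¹ ^ (n - 1))),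
          ← ENNReal.ofReal_mul (by positivity), hreal, mul_comm α β,
          ENNReal.ofReal_mul hβ0.le, ENNReal.ofReal_mul hβ0.le]
        ring

theorem lintegral_rpow_singularity {n : ℕ} (hn : 2 ≤ n) :
    ∫⁻ s in Ioc (0 : ℝ) 1, ENNReal.ofReal (s ^ (-1 + 1 / (n : ℝ))) = n := by
  have hn0 : (0 : ℝ) < n := by positivity
  have hexp : -1 < -1 + 1 / (n : ℝ) := by
    have : 0 < 1 / (n : ℝ) := by positivity
    linarith
  have hint := intervalIntegral.intervalIntegrable_rpow' (a := 0) (b := 1) hexp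
  rw [intervalIntegrable_iff_integrableOn_Ioc_of_le zero_le_one] at hint
  rw [← ofReal_integral_eq_lintegral_ofReal hint, ← intervalIntegral.integral_of_le zero_le_one,
    integral_rpow (Or.inl hexp)]
  · rw [neg_add_cancel_comm, Real.one_rpow, Real.zero_rpow (by positivity)]
    simp
  · filter_upwards [ae_restrict_mem measurableSet_Ioc] with s hs
    exact Real.rpow_nonneg hs.1.le _

/-- If every Lipschitz path on the unit sphere from `a` to `b` has `ψ`-length at least `1 / κ`, then
the `n`-th power of `ψ` has integral at least a constant times `κ ^ (-n)` over the sphere. -/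
theorem sphere_lower_bound {n : ℕ} (hn : 2 ≤ n) {ψ : Space n → ℝ≥0∞} (hψ : Measurable ψ)
    {a b : Space n} (ha : ‖a‖ = 1) (hb : ‖b‖ = 1) {κ : ℝ} (hκ : 0 < κ)
    (h : ∀ (σ : ℝ → Space n) (L : ℝ≥0), LipschitzOnWith L σ (Icc (-1) 1) →
      (∀ t ∈ Icc (-1 : ℝ) 1, ‖σ t‖ = 1) → σ (-1) = a → σ 1 = b →
      1 ≤ ENNReal.ofReal κ * (L * ∫⁻ t in Icc (-1 : ℝ) 1, ψ (σ t))) :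
    volume (Metric.ball (0 : Space n) (1 / 4)) / 2 ≤ ENNReal.ofReal ((160 * n * κ) ^ n) *
      ∫⁻ θ, ψ (θ : Space n) ^ n ∂(volume : Measure (Space n)).toSphere := by
  obtain ⟨q, hq, hqab, haq⟩ := exists_norm_one_inner_eq hn a b
  have hbq : 0 ≤ inner ℝ b q := hqab ▸ haq
  set G := ∫⁻ θ, ψ (θ : Space n) ^ n ∂(volume : Measure (Space n)).toSphere with hG
  set V := volume (Metric.ball (0 : Space n) (1 / 4)) with hV
  have hVtop : V ≠ ⊤ := measure_ball_lt_top.ne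
  have hn0 : (0 : ℝ) < n := by positivity
  -- With this level, the first term of Young's inequality accounts for half of `V`.
  set α : ℝ := (80 * n * κ)⁻¹ with hα
  have hα0 : 0 < α := by positivity
  set B := ENNReal.ofReal α * V + ENNReal.ofReal (α⁻¹ ^ (n - 1)) * (2 ^ n * G) with hB
  have hI : ∀ e : Space n, ‖e‖ = 1 → 0 ≤ inner ℝ e q →
      ∫⁻ w in Metric.ball q (1 / 4), ∫⁻ s in Icc (0 : ℝ) 1, radialExt ψ (e + s • (w - e)) ≤
        n * B := by
    intro e he heq
    have hm : Measurable (Function.uncurry fun (w : Space n) (s : ℝ) =>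
        radialExt ψ (e + s • (w - e))) :=
      (measurable_radialExt hψ).comp (by fun_prop)
    rw [lintegral_lintegral_swap hm.aemeasurable, setLIntegral_congr Ioc_ae_eq_Icc.symm]
    calc _ ≤ ∫⁻ s in Ioc (0 : ℝ) 1, ENNReal.ofReal (s ^ (-1 + 1 / (n : ℝ))) * B :=
          setLIntegral_mono' measurableSet_Ioc fun s hs =>
            lintegral_radialExt_le hn hψ he hq heq hs hα0
      _ = n * B := by
          rw [lintegral_mul_const _ (by fun_prop), lintegral_rpow_singularity hn]
  have hmain : V ≤ ENNReal.ofReal κ * (20 * (n * B + n * B)) := by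
    calc V = ∫⁻ w in Metric.ball q (1 / 4), 1 := by
          rw [setLIntegral_one, Measure.addHaar_ball_center]
      _ ≤ ∫⁻ w in Metric.ball q (1 / 4), ENNReal.ofReal κ * (20 *
            ((∫⁻ s in Icc (0 : ℝ) 1, radialExt ψ (a + s • (w - a))) +
              ∫⁻ s in Icc (0 : ℝ) 1, radialExt ψ (b + s • (w - b)))) := by
          refine setLIntegral_mono' measurableSet_ball fun w hw => ?_
          have hw' : ‖w - q‖ < 1 / 4 := by rwa [← dist_eq_norm]
          obtain ⟨h1, h2, h3, h4⟩ := brokenArc_properties ha hb hq haq hbq hw'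
          refine (h _ _ h1 h2 h3 h4).trans ?_
          have := lintegral_brokenArc_le ψ a w b
          rw [ENNReal.coe_ofNat]
          gcongr
      _ = ENNReal.ofReal κ * (20 * ((∫⁻ w in Metric.ball q (1 / 4),
            ∫⁻ s in Icc (0 : ℝ) 1, radialExt ψ (a + s • (w - a))) +
              ∫⁻ w in Metric.ball q (1 / 4),
                ∫⁻ s in Icc (0 : ℝ) 1, radialExt ψ (b + s • (w - b)))) := by
          have hm : Measurable fun w : Space n =>
              ∫⁻ s in Icc (0 : ℝ) 1, radialExt ψ (a + s • (w - a)) := by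
            refine Measurable.lintegral_prod_right' (f := fun p : Space n × ℝ =>
              radialExt ψ (a + p.2 • (p.1 - a))) ?_
            exact (measurable_radialExt hψ).comp (by fun_prop)
          rw [lintegral_const_mul' _ _ ENNReal.ofReal_ne_top,
            lintegral_const_mul' _ _ (by norm_num), lintegral_add_left hm]
      _ ≤ _ := by
          gcongr
          · exact hI a ha haq
          · exact hI b hb hbq
  have hfirst : ENNReal.ofReal κ * (20 * (n * B + n * B)) =
      V / 2 + ENNReal.ofReal ((160 * n * κ) ^ n) * G / 2 := by
    have e1 : ENNReal.ofReal κ * (20 * (n * B + n * B)) = ENNReal.ofReal (40 * n * κ) * B := by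
      rw [ENNReal.ofReal_mul (by positivity), ENNReal.ofReal_mul (by norm_num),
        ENNReal.ofReal_natCast, show ENNReal.ofReal 40 = 40 by norm_num]
      ring
    have e2 : ENNReal.ofReal (40 * n * κ) * ENNReal.ofReal α = 2⁻¹ := by
      rw [← ENNReal.ofReal_mul (by positivity), hα,
        show 40 * (n : ℝ) * κ * (80 * n * κ)⁻¹ = 2⁻¹ by field_simp; norm_num,
        ENNReal.ofReal_inv_of_pos (by norm_num)]
      norm_num
    have e3 : ENNReal.ofReal (40 * n * κ) * ENNReal.ofReal (α⁻¹ ^ (n - 1)) * 2 ^ n =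
        ENNReal.ofReal ((160 * n * κ) ^ n) * 2⁻¹ := by
      have h22 : (2 : ℝ≥0∞) ^ n = ENNReal.ofReal (2 ^ n) := by
        rw [ENNReal.ofReal_pow (by norm_num)]; norm_num
      have h2i : (2⁻¹ : ℝ≥0∞) = ENNReal.ofReal 2⁻¹ := by
        rw [ENNReal.ofReal_inv_of_pos (by norm_num)]; norm_num
      rw [h22, h2i, ← ENNReal.ofReal_mul (by positivity), ← ENNReal.ofReal_mul (by positivity),
        ← ENNReal.ofReal_mul (by positivity)]
      congr 1
      obtain ⟨k, rfl⟩ : ∃ k, n = k + 1 := ⟨n - 1, by omega⟩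
      rw [hα, inv_inv, Nat.add_sub_cancel,
        show (160 : ℝ) * ((k + 1 : ℕ) : ℝ) * κ = 2 * (80 * ((k + 1 : ℕ) : ℝ) * κ) by ring,
        show (40 : ℝ) * ((k + 1 : ℕ) : ℝ) * κ = 80 * ((k + 1 : ℕ) : ℝ) * κ / 2 by ring]
      generalize 80 * ((k + 1 : ℕ) : ℝ) * κ = z
      rw [mul_pow]
      ring
    rw [e1, hB, mul_add, ← mul_assoc, e2, ← mul_assoc, ← mul_assoc, e3, div_eq_mul_inv,
      div_eq_mul_inv]
    ring
  rw [hfirst] at hmain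
  have hhalf : V / 2 ≤ ENNReal.ofReal ((160 * n * κ) ^ n) * G / 2 := by
    have hadd : V / 2 + V / 2 ≤ V / 2 + ENNReal.ofReal ((160 * n * κ) ^ n) * G / 2 := by
      rwa [ENNReal.add_halves]
    exact (ENNReal.add_le_add_iff_left (ENNReal.div_ne_top hVtop (by norm_num))).1 hadd
  exact hhalf.trans ENNReal.half_le_self

/-- Integration of `sphere_lower_bound` over the concentric spheres of a ring: the modulus of a
family of paths that on each sphere of the ring contains all paths between two points of it is at
least a constant times the logarithm of the ratio of the radii. -/
theorem ring_lower_bound {n : ℕ} (hn : 2 ≤ n) {ρ : Space n → ℝ≥0∞} (hρ : Measurable ρ)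
    {x : Space n} {r₁ r₂ : ℝ} (hr₁ : 0 < r₁) (hr : r₁ < r₂)
    (h : ∀ r ∈ Ioo r₁ r₂, ∃ a b : Space n, ‖a - x‖ = r ∧ ‖b - x‖ = r ∧
      ∀ (σ : ℝ → Space n) (L : ℝ≥0), LipschitzOnWith L σ (Icc (-1) 1) →
        (∀ t ∈ Icc (-1 : ℝ) 1, ‖σ t - x‖ = r) → σ (-1) = a → σ 1 = b →
        1 ≤ L * ∫⁻ t in Icc (-1 : ℝ) 1, ρ (σ t)) :
    volume (Metric.ball (0 : Space n) (1 / 4)) / 2 * ENNReal.ofReal (Real.log (r₂ / r₁)) ≤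
      ENNReal.ofReal ((160 * n) ^ n) * ∫⁻ y, ρ y ^ n := by
  set V := volume (Metric.ball (0 : Space n) (1 / 4)) with hV
  set G : ℝ → ℝ≥0∞ := fun r =>
    ∫⁻ θ, ρ (x + r • (θ : Space n)) ^ n ∂(volume : Measure (Space n)).toSphere with hG
  have hpt : ∀ r ∈ Ioo r₁ r₂, V / 2 * ENNReal.ofReal r⁻¹ ≤
      ENNReal.ofReal ((160 * n) ^ n) * (ENNReal.ofReal (r ^ (n - 1)) * G r) := by
    intro r hrm
    have hr0 : 0 < r := hr₁.trans hrm.1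
    obtain ⟨a, b, ha, hb, hab⟩ := h r hrm
    have hnorm : ∀ c : Space n, ‖c - x‖ = r → ‖r⁻¹ • (c - x)‖ = 1 := by
      intro c hc
      rw [norm_smul, hc, norm_inv, Real.norm_of_nonneg hr0.le, inv_mul_cancel₀ hr0.ne']
    have hback : ∀ c : Space n, x + r • r⁻¹ • (c - x) = c := by
      intro c
      rw [smul_inv_smul₀ hr0.ne', add_sub_cancel]
    have key := sphere_lower_bound hn (ψ := fun y => ρ (x + r • y)) (by fun_prop)
      (hnorm a ha) (hnorm b hb) hr0 (by
        intro σ L hσ h1 h2 h3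
        have hlip : LipschitzOnWith (r.toNNReal * L) (fun t => x + r • σ t) (Icc (-1) 1) := by
          refine LipschitzOnWith.of_dist_le_mul fun s hs t ht => ?_
          rw [dist_add_left, dist_smul₀, Real.norm_of_nonneg hr0.le, NNReal.coe_mul, mul_assoc,
            Real.coe_toNNReal r hr0.le]
          exact mul_le_mul_of_nonneg_left (hσ.dist_le_mul s hs t ht) hr0.le
        have := hab _ _ hlip (fun t ht => by
          rw [add_sub_cancel_left, norm_smul, h1 t ht, mul_one, Real.norm_of_nonneg hr0.le])
          (by rw [h2, hback]) (by rw [h3, hback])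
        rwa [ENNReal.coe_mul, mul_assoc] at this)
    calc V / 2 * ENNReal.ofReal r⁻¹
        ≤ ENNReal.ofReal ((160 * n * r) ^ n) * G r * ENNReal.ofReal r⁻¹ := by gcongr
      _ = ENNReal.ofReal ((160 * n) ^ n) * (ENNReal.ofReal (r ^ (n - 1)) * G r) := by
          rw [mul_right_comm, ← ENNReal.ofReal_mul (by positivity), ← mul_assoc,
            ← ENNReal.ofReal_mul (by positivity)]
          congr 2
          obtain ⟨k, rfl⟩ : ∃ k, n = k + 1 := ⟨n - 1, by omega⟩
          rw [mul_pow, Nat.add_sub_cancel, pow_succ r]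
          field_simp
  have hlog : ∫⁻ r in Ioo r₁ r₂, ENNReal.ofReal r⁻¹ = ENNReal.ofReal (Real.log (r₂ / r₁)) := by
    have hint : IntervalIntegrable (fun r : ℝ => r⁻¹) volume r₁ r₂ :=
      intervalIntegral.intervalIntegrable_inv
        (fun t ht => by
          rw [uIcc_of_le hr.le] at ht
          exact (hr₁.trans_le ht.1).ne') continuousOn_id
    rw [intervalIntegrable_iff_integrableOn_Ioc_of_le hr.le] at hint
    rw [setLIntegral_congr Ioo_ae_eq_Ioc, ← ofReal_integral_eq_lintegral_ofReal hint,
      ← intervalIntegral.integral_of_le hr.le, integral_inv_of_pos hr₁ (hr₁.trans hr)]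
    filter_upwards [ae_restrict_mem measurableSet_Ioc] with s hs
    exact inv_nonneg.2 (hr₁.trans hs.1).le
  calc V / 2 * ENNReal.ofReal (Real.log (r₂ / r₁))
      = ∫⁻ r in Ioo r₁ r₂, V / 2 * ENNReal.ofReal r⁻¹ := by
        rw [lintegral_const_mul _ (by fun_prop), hlog]
    _ ≤ ∫⁻ r in Ioo r₁ r₂,
          ENNReal.ofReal ((160 * n) ^ n) * (ENNReal.ofReal (r ^ (n - 1)) * G r) :=
        setLIntegral_mono' measurableSet_Ioo hpt
    _ ≤ ∫⁻ r in Ioi (0 : ℝ),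
          ENNReal.ofReal ((160 * n) ^ n) * (ENNReal.ofReal (r ^ (n - 1)) * G r) :=
        lintegral_mono_set fun r hr' => hr₁.trans hr'.1
    _ = ENNReal.ofReal ((160 * n) ^ n) * ∫⁻ y, ρ y ^ n := by
        rw [lintegral_const_mul' _ _ ENNReal.ofReal_ne_top,
          ← lintegral_eq_lintegral_sphere hn (F := fun y => ρ (x + y) ^ n) (by fun_prop),
          lintegral_add_left_eq_self (fun y => ρ y ^ n) x]

/-! ### A uniformly bounded density admissible for short crossings -/

theorem Admissible.mono {n : ℕ} {Γ : Set (PPath (OnePoint (Space n)))} {ρ ρ' : Space n → ℝ≥0∞}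
    (h : Admissible Γ ρ) (hρ' : Measurable ρ') (hle : ∀ x, ρ x ≤ ρ' x) : Admissible Γ ρ' := by
  refine ⟨hρ', fun p hp γ hγ hbv => (h.2 p hp γ hγ hbv).trans ?_⟩
  refine iSup_mono fun a => iSup_mono fun b => iSup_mono fun _ => iSup_mono fun _ =>
    iSup_mono fun _ => lintegral_mono fun s => hle _

/-- The bound for the modulus of the paths crossing a ring of width `ε / 8`, with constant `η`. -/
theorem modulus_imagePaths_le {n : ℕ} {D : Set (Space n)} {Q : Space n → ℝ≥0∞}
    {f : D → OnePoint (Space n)} {k : Space n} (hf : IsRingMapAt Q f k) {ε : ℝ} (hε : 0 < ε)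
    {x y : Space n} (hx : x ∈ D) (hy : y ∈ D) (hxy : ε ≤ dist x y) :
    modulus (imagePaths f (joiningPaths (Metric.sphere k (ε / 8)) (Metric.sphere k (ε / 4)) D)) ≤
      (∫⁻ z in D, Q z) * ENNReal.ofReal (8 / ε) ^ n := by
  have hsup : ENNReal.ofReal (ε / 4) < ⨆ z ∈ D, edist z k := by
    have htri := dist_triangle_right x y k
    have hex : ∃ z ∈ D, ε / 4 < dist z k := by
      by_contra! hcon
      linarith [hcon x hx, hcon y hy]
    obtain ⟨z, hz, hlt⟩ := hex
    refine lt_of_lt_of_le ?_ (le_iSup₂ (f := fun z (_ : z ∈ D) => edist z k) z hz)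
    rw [edist_dist]
    exact (ENNReal.ofReal_lt_ofReal_iff (by linarith)).2 hlt
  have hη : (1 : ℝ≥0∞) ≤ ∫⁻ _ in Ioo (ε / 8) (ε / 4), ENNReal.ofReal (8 / ε) := by
    rw [setLIntegral_const, Real.volume_Ioo, ← ENNReal.ofReal_mul (by positivity),
      show 8 / ε * (ε / 4 - ε / 8) = 1 by field_simp; norm_num, ENNReal.ofReal_one]
  refine (hf (ε / 8) (ε / 4) (by positivity) (by linarith) hsup (fun _ => ENNReal.ofReal (8 / ε))
    aemeasurable_const hη).trans ?_
  rw [lintegral_mul_const' _ _ (ENNReal.pow_ne_top ENNReal.ofReal_ne_top)]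
  gcongr
  exact inter_subset_right

/-- The centres `k` are those of a finite cover of `D`, and `ρ` is the `n`-th root of the sum of the
`n`-th powers of densities that are almost extremal for the finitely many rings. -/
theorem exists_uniform_density {n : ℕ} (hn : 2 ≤ n) {D : Set (Space n)}
    (hDb : Bornology.IsBounded D) (D' : Set (OnePoint (Space n))) {Q : Space n → ℝ≥0∞}
    (hQ : ∫⁻ x in D, Q x < ⊤) {ε : ℝ} (hε : 0 < ε) :
    ∃ K : ℝ≥0∞, K ≠ ⊤ ∧ ∀ g ∈ ringFamily Q D D', ∀ x ∈ D, ∀ y ∈ D, ε ≤ dist x y →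
      ∃ ρ : Space n → ℝ≥0∞, Measurable ρ ∧ ∫⁻ z, ρ z ^ n ≤ K ∧
        ∀ z ∈ D, ∃ k, dist z k < ε / 8 ∧
          Admissible (imagePaths (fun x : D => (g.symm x : OnePoint (Space n)))
            (joiningPaths (Metric.sphere k (ε / 8)) (Metric.sphere k (ε / 4)) D)) ρ := by
  have hε8 : 0 < ε / 8 := by positivity
  have htb : TotallyBounded D :=
    (Bornology.IsBounded.isCompact_closure hDb).totallyBounded.subset subset_closure
  obtain ⟨t, htD, htfin, hcov⟩ := htb.exists_subset (Metric.dist_mem_uniformity hε8)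
  set M := (∫⁻ z in D, Q z) * ENNReal.ofReal (8 / ε) ^ n with hM
  have hMtop : M ≠ ⊤ := ENNReal.mul_ne_top hQ.ne (ENNReal.pow_ne_top ENNReal.ofReal_ne_top)
  refine ⟨∑ _k ∈ htfin.toFinset, (M + 1), by simp [ENNReal.mul_eq_top, hMtop], ?_⟩
  intro g hg x hx y hy hxy
  have hex : ∀ k : Space n, ∃ ρ : Space n → ℝ≥0∞, k ∈ t →
      Admissible (imagePaths (fun x : D => (g.symm x : OnePoint (Space n)))
        (joiningPaths (Metric.sphere k (ε / 8)) (Metric.sphere k (ε / 4)) D)) ρ ∧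
      ∫⁻ z, ρ z ^ n < M + 1 := by
    intro k
    by_cases hk : k ∈ t
    · have h1 := modulus_imagePaths_le (hg k (htD hk)) hε hx hy hxy
      have h2 := h1.trans_lt (ENNReal.lt_add_right hMtop one_ne_zero)
      obtain ⟨ρ, hρ⟩ := iInf_lt_iff.1 h2
      obtain ⟨hadm, hlt⟩ := iInf_lt_iff.1 hρ
      exact ⟨ρ, fun _ => ⟨hadm, hlt⟩⟩
    · exact ⟨0, fun h => absurd h hk⟩
  choose ρ hρ using hex
  have hn0 : n ≠ 0 := by omega
  have hρm : ∀ k ∈ htfin.toFinset, Measurable (ρ k) := fun k hk =>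
    (hρ k (htfin.mem_toFinset.1 hk)).1.1
  have hsm : Measurable fun z => ∑ k ∈ htfin.toFinset, ρ k z ^ n :=
    Finset.measurable_sum _ fun k hk => (hρm k hk).pow_const n
  refine ⟨fun z => (∑ k ∈ htfin.toFinset, ρ k z ^ n) ^ ((n : ℝ)⁻¹), hsm.pow_const _, ?_, ?_⟩
  · calc ∫⁻ z, ((∑ k ∈ htfin.toFinset, ρ k z ^ n) ^ ((n : ℝ)⁻¹)) ^ n
        = ∫⁻ z, ∑ k ∈ htfin.toFinset, ρ k z ^ n :=
          lintegral_congr fun z => ENNReal.rpow_inv_natCast_pow hn0 _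
      _ = ∑ k ∈ htfin.toFinset, ∫⁻ z, ρ k z ^ n :=
          lintegral_finsetSum _ fun k hk => (hρm k hk).pow_const n
      _ ≤ _ := Finset.sum_le_sum fun k hk => (hρ k (htfin.mem_toFinset.1 hk)).2.le
  · intro z hz
    obtain ⟨k, hk, hzk⟩ := mem_iUnion₂.1 (hcov hz)
    refine ⟨k, hzk, (hρ k hk).1.mono (hsm.pow_const _) fun w => ?_⟩
    calc ρ k w = (ρ k w ^ n) ^ ((n : ℝ)⁻¹) := (ENNReal.pow_rpow_inv_natCast hn0 _).symm
      _ ≤ _ := ENNReal.rpow_le_rpow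
          (Finset.single_le_sum (f := fun k => ρ k w ^ n) (fun _ _ => zero_le)
            (htfin.mem_toFinset.2 hk)) (by positivity)

/-! ### Paths whose preimages join distant points -/

/-- A density admissible for the crossings of small rings about points that are dense enough in `D`
has integral at least one along every Lipschitz path in `D'` whose preimage in `D` joins two points
at distance at least `ε`. -/
theorem one_le_lintegral_of_far {n : ℕ} {D : Set (Space n)} {D' : Set (OnePoint (Space n))}
    (g : D' ≃ₜ D) {ε : ℝ} (hε : 0 < ε) {ρ : Space n → ℝ≥0∞}
    (hρ : ∀ z ∈ D, ∃ k, dist z k < ε / 8 ∧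
      Admissible (imagePaths (fun x : D => (g.symm x : OnePoint (Space n)))
        (joiningPaths (Metric.sphere k (ε / 8)) (Metric.sphere k (ε / 4)) D)) ρ)
    {σ : ℝ → Space n} {L : ℝ≥0} (hσ : LipschitzOnWith L σ (Icc (-1) 1))
    (hσD : ∀ t ∈ Icc (-1 : ℝ) 1, (σ t : OnePoint (Space n)) ∈ D')
    {a b : Space n} (ha : (a : OnePoint (Space n)) ∈ D') (hb : (b : OnePoint (Space n)) ∈ D')
    (hσa : σ (-1) = a) (hσb : σ 1 = b)
    (hab : ε ≤ dist (g ⟨a, ha⟩ : Space n) (g ⟨b, hb⟩)) :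
    1 ≤ L * ∫⁻ t in Icc (-1 : ℝ) 1, ρ (σ t) := by
  classical
  subst hσa hσb
  -- `γ` is the preimage `g ∘ σ`; the value `0` is not used on `[-1, 1]`.
  set γ : ℝ → Space n := fun t =>
    if h : (σ t : OnePoint (Space n)) ∈ D' then (g ⟨σ t, h⟩ : Space n) else 0 with hγ
  have hγval : ∀ t (h : (σ t : OnePoint (Space n)) ∈ D'), γ t = g ⟨σ t, h⟩ := fun t h => dif_pos h
  have hγD : ∀ t ∈ Icc (-1 : ℝ) 1, γ t ∈ D := fun t ht => by
    rw [hγval t (hσD t ht)]; exact (g _).2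
  have hsymm : ∀ t ∈ Icc (-1 : ℝ) 1, ∀ h : γ t ∈ D,
      (g.symm ⟨γ t, h⟩ : OnePoint (Space n)) = σ t := by
    intro t ht h
    have : (⟨γ t, h⟩ : D) = g ⟨σ t, hσD t ht⟩ := Subtype.ext (hγval t (hσD t ht))
    rw [this, g.symm_apply_apply]
  have hγc : ContinuousOn γ (Icc (-1) 1) := by
    rw [continuousOn_iff_continuous_domRestrict]
    have h1 : Continuous fun t : Icc (-1 : ℝ) 1 =>
        (⟨(σ t : OnePoint (Space n)), hσD t t.2⟩ : D') :=
      Continuous.subtype_mk (OnePoint.continuous_coe.comp hσ.continuousOn.domRestrict) _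
    refine (continuous_subtype_val.comp (g.continuous.comp h1)).congr fun t => ?_
    exact (hγval t (hσD t t.2)).symm
  have hm1 : (-1 : ℝ) ∈ Icc (-1 : ℝ) 1 := by norm_num
  have hp1 : (1 : ℝ) ∈ Icc (-1 : ℝ) 1 := by norm_num
  obtain ⟨k, hk, hadm⟩ := hρ (γ (-1)) (hγD _ hm1)
  have hfar : ε ≤ dist (γ (-1)) (γ 1) := by
    rw [hγval _ (hσD _ hm1), hγval _ (hσD _ hp1)]
    exact hab
  have huc : ContinuousOn (fun t => dist (γ t) k) (Icc (-1) 1) := by fun_prop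
  have hend : ε / 4 ≤ dist (γ 1) k := by
    have := dist_triangle_right (γ (-1)) (γ 1) k
    linarith
  obtain ⟨t₂, ht₂, hu₂⟩ : ∃ t ∈ Icc (-1 : ℝ) 1, dist (γ t) k = ε / 4 :=
    intermediate_value_Icc (by norm_num) huc ⟨by linarith, hend⟩
  obtain ⟨t₁, ht₁, hu₁⟩ : ∃ t ∈ Icc (-1 : ℝ) t₂, dist (γ t) k = ε / 8 :=
    intermediate_value_Icc ht₂.1 (huc.mono (Icc_subset_Icc_right ht₂.2))
      ⟨hk.le, by simp only [hu₂]; linarith⟩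
  have hlt : t₁ < t₂ := by
    refine lt_of_le_of_ne ht₁.2 fun h => ?_
    rw [h] at hu₁
    linarith
  have hsub : Icc t₁ t₂ ⊆ Icc (-1) 1 := Icc_subset_Icc ht₁.1 ht₂.2
  have hmaps : MapsTo (fun t : ℝ => t₁ + t * (t₂ - t₁)) (Icc 0 1) (Icc t₁ t₂) := by
    intro t ht
    constructor <;> nlinarith [ht.1, ht.2]
  obtain ⟨hlip, hle⟩ := arcIntegral_comp_affine_le ρ hlt (hσ.mono hsub)
  set p : PPath (OnePoint (Space n)) :=
    ⟨Icc 0 1, fun t => (σ (t₁ + t * (t₂ - t₁)) : OnePoint (Space n))⟩ with hp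
  have hpmem : p ∈ imagePaths (fun x : D => (g.symm x : OnePoint (Space n)))
      (joiningPaths (Metric.sphere k (ε / 8)) (Metric.sphere k (ε / 4)) D) := by
    refine ⟨fun t => γ (t₁ + t * (t₂ - t₁)), ⟨?_, ?_, ?_, ?_⟩, ?_, ?_⟩
    · exact (hγc.mono hsub).comp (by fun_prop) hmaps
    · simpa [dist_eq_norm] using hu₁
    · simpa [dist_eq_norm] using hu₂
    · exact fun t ht => hγD _ (hsub (hmaps (Ioo_subset_Icc_self ht)))
    · refine Subset.antisymm (fun t ht => ⟨ht, hγD _ (hsub (hmaps ht))⟩) fun t ht => ht.1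
    · exact fun t ht h => (hsymm _ (hsub (hmaps ht)) h).symm
  have h1 := hadm.2 p hpmem (fun t => σ (t₁ + t * (t₂ - t₁))) (fun t _ => rfl)
    hlip.locallyBoundedVariationOn
  refine h1.trans (hle.trans ?_)
  gcongr

/-- The modulus estimate in its final form: a ring in `D'` each of whose spheres carries two points
with preimages at distance at least `ε` has a bounded ratio of radii. -/
theorem exists_ratio_bound {n : ℕ} (hn : 2 ≤ n) {D : Set (Space n)}
    (hDb : Bornology.IsBounded D) (D' : Set (OnePoint (Space n))) {Q : Space n → ℝ≥0∞}
    (hQ : ∫⁻ x in D, Q x < ⊤) {ε : ℝ} (hε : 0 < ε) :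
    ∃ Λ : ℝ, 1 < Λ ∧ ∀ g ∈ ringFamily Q D D', ∀ (x : Space n) (r₁ r₂ : ℝ), 0 < r₁ → r₁ < r₂ →
      (∀ z : Space n, r₁ < ‖z - x‖ → ‖z - x‖ < r₂ → (z : OnePoint (Space n)) ∈ D') →
      (∀ r ∈ Ioo r₁ r₂, ∃ (a b : Space n) (ha : (a : OnePoint (Space n)) ∈ D')
        (hb : (b : OnePoint (Space n)) ∈ D'), ‖a - x‖ = r ∧ ‖b - x‖ = r ∧
          ε ≤ dist (g ⟨a, ha⟩ : Space n) (g ⟨b, hb⟩)) →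
      r₂ < Λ * r₁ := by
  obtain ⟨K, hK, hKρ⟩ := exists_uniform_density hn hDb D' hQ hε
  set V := volume (Metric.ball (0 : Space n) (1 / 4)) / 2 with hV
  set C := ENNReal.ofReal ((160 * n) ^ n) * K with hC
  have hCtop : C ≠ ⊤ := ENNReal.mul_ne_top ENNReal.ofReal_ne_top hK
  have hV0 : V ≠ 0 :=
    (ENNReal.half_pos (Metric.measure_ball_pos volume _ (by norm_num)).ne').ne'
  have hVtop : V ≠ ⊤ := ENNReal.div_ne_top measure_ball_lt_top.ne (by norm_num)
  have hCV : C / V ≠ ⊤ := ENNReal.div_ne_top hCtop hV0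
  refine ⟨Real.exp ((C / V).toReal + 1), Real.one_lt_exp_iff.2 (by positivity), ?_⟩
  intro g hg x r₁ r₂ hr₁ hr hring hab
  by_contra! hcon
  obtain ⟨a₀, b₀, ha₀, hb₀, -, -, hab₀⟩ := hab ((r₁ + r₂) / 2) ⟨by linarith, by linarith⟩
  obtain ⟨ρ, hρm, hρK, hρadm⟩ := hKρ g hg _ (g ⟨a₀, ha₀⟩).2 _ (g ⟨b₀, hb₀⟩).2 hab₀
  have hlow := ring_lower_bound hn hρm (x := x) hr₁ hr (by
    intro r hrm
    obtain ⟨a, b, ha, hb, hax, hbx, hdist⟩ := hab r hrm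
    refine ⟨a, b, hax, hbx, fun σ L hσ hσr hσa hσb => ?_⟩
    refine one_le_lintegral_of_far g hε hρadm hσ (fun t ht => hring _ ?_ ?_) ha hb hσa hσb hdist
    · rw [hσr t ht]; exact hrm.1
    · rw [hσr t ht]; exact hrm.2)
  have hlog : (C / V).toReal + 1 ≤ Real.log (r₂ / r₁) := by
    rw [Real.le_log_iff_exp_le (div_pos (hr₁.trans hr) hr₁), le_div_iff₀ hr₁]
    exact hcon
  have h1 : ENNReal.ofReal (Real.log (r₂ / r₁)) ≤ C / V := by
    rw [ENNReal.le_div_iff_mul_le (Or.inl hV0) (Or.inl hVtop), mul_comm]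
    exact hlow.trans (mul_le_mul' le_rfl hρK)
  have h2 := ENNReal.ofReal_le_iff_le_toReal hCV |>.1 ((ENNReal.ofReal_le_ofReal hlog).trans h1)
  linarith

/-! ### Rays in a bounded domain -/

/-- A ray in direction `u` from a point of `g(U)` leaves `g(U)` through `g(K \ U)`, when `U` is an
open subset of a compact subset `K` of `D'`. -/
theorem exists_mem_ray {n : ℕ} {D : Set (Space n)} (hD : IsOpen D) (hDb : Bornology.IsBounded D)
    {D' : Set (OnePoint (Space n))} (g : D' ≃ₜ D) {U K : Set (OnePoint (Space n))}
    (hU : IsOpen U) (hK : IsCompact K) (hUK : U ⊆ K) (hKD : K ⊆ D') (y : D')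
    (hy : (y : OnePoint (Space n)) ∈ U) {u : Space n} (hu : u ≠ 0) :
    ∃ z : D', (z : OnePoint (Space n)) ∈ K \ U ∧
      ∃ s : ℝ, 0 ≤ s ∧ (g z : Space n) = g y + s • u := by
  set V : Set (Space n) := (fun z : D' => (g z : Space n)) '' {z | (z : OnePoint (Space n)) ∈ U}
    with hV
  set W : Set (Space n) := (fun z : D' => (g z : Space n)) '' {z | (z : OnePoint (Space n)) ∈ K}
    with hW
  have hVopen : IsOpen V :=
    (hD.isOpenMap_subtype_val.comp g.isOpenMap) _ (hU.preimage continuous_subtype_val)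
  have hWclosed : IsClosed W := by
    have hc : IsCompact {z : D' | (z : OnePoint (Space n)) ∈ K} := by
      rw [Subtype.isCompact_iff]
      convert hK
      ext z
      constructor
      · rintro ⟨w, hw, rfl⟩; exact hw
      · exact fun hz => ⟨⟨z, hKD hz⟩, hz, rfl⟩
    exact (hc.image (continuous_subtype_val.comp g.continuous)).isClosed
  have hVW : V ⊆ W := image_mono fun z hz => hUK hz
  -- The absolute value makes the ray the image of the whole line.
  set φ : ℝ → Space n := fun t => (g y : Space n) + |t| • u with hφ
  have hφc : Continuous φ := by fun_prop
  have hne : (φ ⁻¹' V).Nonempty := ⟨0, y, hy, by simp [hφ]⟩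
  have hnu : φ ⁻¹' V ≠ univ := by
    intro h
    obtain ⟨R, hR⟩ := hDb.exists_norm_le
    have hupos : 0 < ‖u‖ := norm_pos_iff.2 hu
    have hmem : φ ((R + ‖(g y : Space n)‖ + 1) / ‖u‖) ∈ V := by
      have : (R + ‖(g y : Space n)‖ + 1) / ‖u‖ ∈ φ ⁻¹' V := h ▸ mem_univ _
      exact this
    obtain ⟨z, -, hz⟩ := hmem
    have h1 := hR _ (g z).2
    rw [show (g z : Space n) = φ ((R + ‖(g y : Space n)‖ + 1) / ‖u‖) from hz] at h1
    have h2 : ‖|(R + ‖(g y : Space n)‖ + 1) / ‖u‖| • u‖ ≤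
        ‖φ ((R + ‖(g y : Space n)‖ + 1) / ‖u‖)‖ + ‖(g y : Space n)‖ := by
      have := norm_sub_le (φ ((R + ‖(g y : Space n)‖ + 1) / ‖u‖)) (g y : Space n)
      simpa [hφ] using this
    rw [norm_smul, Real.norm_eq_abs, abs_abs] at h2
    have h3 : R + ‖(g y : Space n)‖ + 1 ≤ |(R + ‖(g y : Space n)‖ + 1) / ‖u‖| * ‖u‖ := by
      calc R + ‖(g y : Space n)‖ + 1 = (R + ‖(g y : Space n)‖ + 1) / ‖u‖ * ‖u‖ := by
            field_simp
        _ ≤ _ := by gcongr; exact le_abs_self _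
    linarith
  obtain ⟨t, ht⟩ := nonempty_frontier_iff.2 ⟨hne, hnu⟩
  have hfr : φ t ∈ frontier V := hφc.frontier_preimage_subset V ht
  rw [hVopen.frontier_eq] at hfr
  obtain ⟨z, hzK, hz⟩ := closure_minimal hVW hWclosed hfr.1
  exact ⟨z, ⟨hzK, fun hzU => hfr.2 ⟨z, hzU, hz⟩⟩, |t|, abs_nonneg t, hz⟩

/-- Two opposite rays from the preimages of two points of `U` meet `g(K \ U)` in points that are
at least as far from each other as the origins of the rays. -/
theorem exists_pair_dist_ge {n : ℕ} {D : Set (Space n)} (hD : IsOpen D)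
    (hDb : Bornology.IsBounded D) {D' : Set (OnePoint (Space n))} (g : D' ≃ₜ D)
    {U K : Set (OnePoint (Space n))} (hU : IsOpen U) (hK : IsCompact K) (hUK : U ⊆ K)
    (hKD : K ⊆ D') (y y₀ : D') (hy : (y : OnePoint (Space n)) ∈ U)
    (hy₀ : (y₀ : OnePoint (Space n)) ∈ U) (hne : (g y : Space n) ≠ g y₀) :
    ∃ z w : D', (z : OnePoint (Space n)) ∈ K \ U ∧ (w : OnePoint (Space n)) ∈ K \ U ∧
      dist (g y : Space n) (g y₀) ≤ dist (g z : Space n) (g w) := by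
  set u : Space n := (g y : Space n) - g y₀ with hu
  have hu0 : u ≠ 0 := sub_ne_zero.2 hne
  obtain ⟨z, hz, s, hs, hzs⟩ := exists_mem_ray hD hDb g hU hK hUK hKD y hy hu0
  obtain ⟨w, hw, t, ht, hwt⟩ := exists_mem_ray hD hDb g hU hK hUK hKD y₀ hy₀ (neg_ne_zero.2 hu0)
  refine ⟨z, w, hz, hw, ?_⟩
  rw [dist_eq_norm, dist_eq_norm, hzs, hwt,
    show (g y : Space n) + s • u - (g y₀ + t • -u) = (1 + s + t) • u by rw [hu]; module,
    norm_smul, Real.norm_of_nonneg (by positivity), ← hu]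
  nlinarith [norm_nonneg u, mul_nonneg hs (norm_nonneg u), mul_nonneg ht (norm_nonneg u)]

/-! ### Chordal neighbourhoods -/

theorem exists_chordal_lt_imp_norm_sub_lt {n : ℕ} (x₀ : Space n) {s : ℝ} (hs : 0 < s) :
    ∃ δ > 0, ∀ y : OnePoint (Space n), chordal y x₀ < δ → ∃ z : Space n, y = z ∧ ‖z - x₀‖ < s := by
  set A := Real.sqrt (1 + ‖x₀‖ ^ 2) with hA
  have hA2 : A ^ 2 = 1 + ‖x₀‖ ^ 2 := Real.sq_sqrt (by positivity)
  have hA0 : 0 < A := Real.sqrt_pos.2 (by positivity)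
  have hxA : ‖x₀‖ ≤ A := Real.le_sqrt_of_sq_le (by linarith)
  refine ⟨min (1 / (2 * A)) (s / (2 * A ^ 2)), by positivity, fun y hy => ?_⟩
  obtain ⟨hy1, hy2⟩ := lt_min_iff.1 hy
  induction y using OnePoint.rec with
  | infty =>
    exfalso
    change 1 / A < 1 / (2 * A) at hy1
    rw [one_div_lt_one_div hA0 (by positivity)] at hy1
    linarith
  | coe z =>
    refine ⟨z, rfl, ?_⟩
    set d := ‖z - x₀‖ with hd
    have hd0 : 0 ≤ d := norm_nonneg _
    set B := Real.sqrt (1 + ‖z‖ ^ 2) with hB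
    have hB0 : 0 < B := Real.sqrt_pos.2 (by positivity)
    have hBle : B ≤ A + d := by
      refine (Real.sqrt_le_left (by positivity)).2 ?_
      have hz : ‖z‖ ≤ ‖x₀‖ + d := norm_le_norm_add_norm_sub' z x₀
      have := pow_le_pow_left₀ (norm_nonneg z) hz 2
      nlinarith [mul_le_mul_of_nonneg_right hxA hd0]
    change d / (B * A) < 1 / (2 * A) at hy1
    change d / (B * A) < s / (2 * A ^ 2) at hy2
    rw [div_lt_div_iff₀ (by positivity) (by positivity)] at hy1 hy2
    -- The two bounds say `2 * d < B` and `2 * A * d < s * B`, where `B ≤ A + d`.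
    have h1 : 2 * d < B := by nlinarith
    have h2 : 2 * A * d < s * B := by nlinarith
    have h3 : d < A := by linarith
    nlinarith

theorem exists_chordal_lt_imp_lt_norm {n : ℕ} (R : ℝ) :
    ∃ δ > 0, ∀ y : OnePoint (Space n), chordal y ∞ < δ →
      y = (∞ : OnePoint (Space n)) ∨ ∃ z : Space n, y = z ∧ R < ‖z‖ := by
  refine ⟨1 / Real.sqrt (1 + R ^ 2), by positivity, fun y hy => ?_⟩
  induction y using OnePoint.rec with
  | infty => exact Or.inl rfl
  | coe z =>
    refine Or.inr ⟨z, rfl, ?_⟩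
    change 1 / Real.sqrt (1 + ‖z‖ ^ 2) < 1 / Real.sqrt (1 + R ^ 2) at hy
    rw [one_div_lt_one_div (by positivity) (by positivity),
      Real.sqrt_lt_sqrt_iff (by positivity)] at hy
    exact lt_of_pow_lt_pow_left₀ 2 (norm_nonneg z) (by linarith)

/-! ### Equicontinuity at finite points and at infinity -/

theorem equicontAt_coe {n : ℕ} (hn : 2 ≤ n) {D : Set (Space n)} (hD : IsOpen D)
    (hDb : Bornology.IsBounded D) {D' : Set (OnePoint (Space n))} (hD' : IsOpen D')
    {Q : Space n → ℝ≥0∞} (hQ : ∫⁻ x in D, Q x < ⊤) (x₀ : Space n)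
    (hx₀ : (x₀ : OnePoint (Space n)) ∈ D') :
    EquicontAt (fun y z : D' => chordal (y : OnePoint (Space n)) z)
      (fun x w : D => dist (x : Space n) w)
      ((fun g : D' ≃ₜ D => (g : D' → D)) '' ringFamily Q D D') ⟨x₀, hx₀⟩ := by
  intro ε hε
  obtain ⟨Λ, hΛ, hratio⟩ := exists_ratio_bound hn hDb D' hQ hε
  obtain ⟨r₀, hr₀, hball⟩ := Metric.isOpen_iff.1 (hD'.preimage OnePoint.continuous_coe) x₀ hx₀
  have hΛ0 : 0 < Λ := by linarith
  obtain ⟨δ, hδ, hchord⟩ := exists_chordal_lt_imp_norm_sub_lt x₀ (s := r₀ / Λ) (by positivity)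
  refine ⟨δ, hδ, ?_⟩
  rintro _ ⟨g, hg, rfl⟩ y hy
  by_contra! hfar
  obtain ⟨z, hz, hzs⟩ := hchord y hy
  rw [lt_div_iff₀ hΛ0] at hzs
  have hne : (g y : Space n) ≠ g ⟨x₀, hx₀⟩ := fun h => by
    simp only [h, dist_self] at hfar
    linarith
  have hz0 : 0 < ‖z - x₀‖ := by
    refine norm_pos_iff.2 (sub_ne_zero.2 fun h => hne ?_)
    rw [show y = ⟨x₀, hx₀⟩ from Subtype.ext (hz.trans (congrArg _ h))]
  have hmem : ∀ w : Space n, ‖w - x₀‖ < r₀ → (w : OnePoint (Space n)) ∈ D' := fun w hw =>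
    hball (mem_ball_iff_norm.2 hw)
  have := hratio g hg x₀ ‖z - x₀‖ r₀ hz0 (by nlinarith) (fun w _ hw => hmem w hw) (by
    intro r hr
    obtain ⟨p, q, hp, hq, hpq⟩ := exists_pair_dist_ge hD hDb g
      (U := (↑) '' Metric.ball x₀ r) (K := (↑) '' Metric.closedBall x₀ r)
      (OnePoint.isOpen_image_coe.2 Metric.isOpen_ball)
      ((isCompact_closedBall x₀ r).image OnePoint.continuous_coe)
      (image_mono Metric.ball_subset_closedBall)
      (by
        rintro _ ⟨w, hw, rfl⟩
        exact hmem w ((mem_closedBall_iff_norm.1 hw).trans_lt hr.2))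
      y ⟨x₀, hx₀⟩ ⟨z, mem_ball_iff_norm.2 hr.1, hz.symm⟩
      ⟨x₀, Metric.mem_ball_self (hz0.trans hr.1), rfl⟩ hne
    have hsph : ∀ p : D', (p : OnePoint (Space n)) ∈
        ((↑) '' Metric.closedBall x₀ r : Set (OnePoint (Space n))) \ (↑) '' Metric.ball x₀ r →
        ∃ a : Space n, (p : OnePoint (Space n)) = a ∧ ‖a - x₀‖ = r := by
      rintro p ⟨⟨a, ha, hap⟩, hp⟩
      refine ⟨a, hap.symm, le_antisymm (mem_closedBall_iff_norm.1 ha) ?_⟩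
      by_contra! hlt
      exact hp ⟨a, mem_ball_iff_norm.2 hlt, hap⟩
    obtain ⟨⟨a, hap, ha⟩, ⟨b, hbq, hb⟩⟩ := And.intro (hsph p hp) (hsph q hq)
    obtain ⟨p, hpD⟩ := p
    obtain ⟨q, hqD⟩ := q
    subst hap hbq
    exact ⟨a, b, hpD, hqD, ha, hb, hfar.trans hpq⟩)
  linarith

theorem equicontAt_infty {n : ℕ} (hn : 2 ≤ n) {D : Set (Space n)} (hD : IsOpen D)
    (hDb : Bornology.IsBounded D) {D' : Set (OnePoint (Space n))} (hD' : IsOpen D')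
    {Q : Space n → ℝ≥0∞} (hQ : ∫⁻ x in D, Q x < ⊤) (hinf : (∞ : OnePoint (Space n)) ∈ D') :
    EquicontAt (fun y z : D' => chordal (y : OnePoint (Space n)) z)
      (fun x w : D => dist (x : Space n) w)
      ((fun g : D' ≃ₜ D => (g : D' → D)) '' ringFamily Q D D') ⟨∞, hinf⟩ := by
  intro ε hε
  obtain ⟨Λ, hΛ, hratio⟩ := exists_ratio_bound hn hDb D' hQ hε
  obtain ⟨R, hR, hRD⟩ : ∃ R : ℝ, 0 < R ∧
      ∀ z : Space n, R < ‖z‖ → (z : OnePoint (Space n)) ∈ D' := by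
    have hc := ((OnePoint.isOpen_iff_of_mem hinf).1 hD').2
    obtain ⟨R, hR⟩ := hc.isBounded.exists_norm_le
    refine ⟨max R 1, by positivity, fun z hz => ?_⟩
    by_contra hzD
    linarith [hR z hzD, le_max_left R 1]
  obtain ⟨δ, hδ, hchord⟩ := exists_chordal_lt_imp_lt_norm (n := n) (Λ * R)
  refine ⟨δ, hδ, ?_⟩
  rintro _ ⟨g, hg, rfl⟩ y hy
  by_contra! hfar
  have hne : (g y : Space n) ≠ g ⟨∞, hinf⟩ := fun h => by
    simp only [h, dist_self] at hfar
    linarith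
  obtain hy' | ⟨z, hz, hzR⟩ := hchord y hy
  · exact hne (by rw [show y = ⟨∞, hinf⟩ from Subtype.ext hy'])
  have := hratio g hg 0 R ‖z‖ hR (by nlinarith)
    (fun w hw _ => hRD w (by rwa [sub_zero] at hw)) (by
    intro r hr
    obtain ⟨p, q, hp, hq, hpq⟩ := exists_pair_dist_ge hD hDb g
      (U := ((↑) '' Metric.closedBall (0 : Space n) r)ᶜ)
      (K := ((↑) '' Metric.ball (0 : Space n) r)ᶜ)
      (OnePoint.isOpen_compl_image_coe.2 ⟨Metric.isClosed_closedBall, isCompact_closedBall _ _⟩)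
      (OnePoint.isOpen_image_coe.2 Metric.isOpen_ball).isClosed_compl.isCompact
      (compl_subset_compl.2 (image_mono Metric.ball_subset_closedBall))
      (by
        intro w hw
        induction w using OnePoint.rec with
        | infty => exact hinf
        | coe w =>
          refine hRD w (hr.1.trans_le ?_)
          by_contra! hlt
          exact hw ⟨w, mem_ball_zero_iff.2 hlt, rfl⟩)
      y ⟨∞, hinf⟩
      (by
        rintro ⟨w, hw, hwy⟩
        have hwz : w = z := OnePoint.coe_injective (hwy.trans hz)
        rw [hwz, mem_closedBall_zero_iff] at hw
        linarith [hr.2])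
      (by
        rintro ⟨w, -, hw⟩
        exact OnePoint.coe_ne_infty w hw) hne
    have hsph : ∀ p : D', (p : OnePoint (Space n)) ∈
        ((↑) '' Metric.ball (0 : Space n) r : Set (OnePoint (Space n)))ᶜ \
          ((↑) '' Metric.closedBall (0 : Space n) r)ᶜ →
        ∃ a : Space n, (p : OnePoint (Space n)) = a ∧ ‖a - 0‖ = r := by
      rintro p ⟨hp, hp'⟩
      obtain ⟨a, ha, hap⟩ := not_not.1 hp'
      refine ⟨a, hap.symm, ?_⟩
      rw [sub_zero]
      refine le_antisymm (mem_closedBall_zero_iff.1 ha) ?_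
      by_contra! hlt
      exact hp ⟨a, mem_ball_zero_iff.2 hlt, hap⟩
    obtain ⟨⟨a, hap, ha⟩, ⟨b, hbq, hb⟩⟩ := And.intro (hsph p hp) (hsph q hq)
    obtain ⟨p, hpD⟩ := p
    obtain ⟨q, hqD⟩ := q
    subst hap hbq
    exact ⟨a, b, hpD, hqD, ha, hb, hfar.trans hpq⟩)
  linarith

end RingHomeo

theorem theorem1 (n : ℕ) (hn : 2 ≤ n)
    (D : Set (RingHomeo.Space n)) (hD : RingHomeo.IsDomainSet D) (hDb : Bornology.IsBounded D)
    (D' : Set (OnePoint (RingHomeo.Space n))) (hD' : RingHomeo.IsDomainSet D')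
    (Q : RingHomeo.Space n → ENNReal)
    (hQm : AEMeasurable Q MeasureTheory.volume) (hQ0 : ∀ x, x ∉ D → Q x = 0)
    (hQ : ∫⁻ x in D, Q x ∂MeasureTheory.volume < ⊤) :
    RingHomeo.Equicont
      (fun y z : D' => RingHomeo.chordal (y : OnePoint (RingHomeo.Space n)) z)
      (fun x w : D => dist (x : RingHomeo.Space n) w)
      ((fun g : D' ≃ₜ D => (g : D' → D)) '' RingHomeo.ringFamily Q D D') := by
  rintro ⟨y₀, hy₀⟩
  induction y₀ using OnePoint.rec with
  | infty => exact RingHomeo.equicontAt_infty hn hD.1 hDb hD'.1 hQ hy₀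
  | coe x₀ => exact RingHomeo.equicontAt_coe hn hD.1 hDb hD'.1 hQ x₀ hy₀
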